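/- Let $1\le\nu\le N-1$, $M\ge N$, $E_s,N_0>0$, $\mathbf H\in\mathbb C^{M\times N}$, and $\mathbf y=\mathbf H\mathbf x+\mathbf z$ with independent $\mathbf x\sim\mathcal{CN}(\mathbf 0,E_s\mathbf I_N)$ and $\mathbf z\sim\mathcal{CN}(\mathbf 0,N_0\mathbf I_M)$. For a metric $\mu(\mathbf y|\mathbf x)$ put $p(\mathbf y|\mathbf x)=\exp\mu(\mathbf y|\mathbf x)$, $p(\mathbf y)=\int p(\mathbf y|\mathbf x)\,p(\mathbf x)\,d\mathbf x$, where $p(\mathbf x)$ is the density of $\mathcal{CN}(\mathbf 0,E_s\mathbf I_N)$, and let $I_{\mathrm{LB}}=\mathbb E_{\mathbf Y,\mathbf X}[\log p(\mathbf y|\mathbf x)]-\mathbb E_{\mathbf Y}[\log p(\mathbf y)]$ be the corresponding lower bound on the achievable information rate (AIR), the expectations being taken under the true channel ($I_{\mathrm{LB}}=-\infty$ if $p(\mathbf y)=\infty$). Call $\mathbf J\in\mathbb C^{N\times N}$ punctured of order $\nu$ if $\mathbf J=\begin{bmatrix}\mathbf J_1&\mathbf 0\\ \mathbf J_2&\mathbf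 J_3\end{bmatrix}$ with $\mathbf J_1\in\mathbb C^{\nu\times\nu}$ lower triangular and $\mathbf J_3$ diagonal. Let $\begin{bmatrix}\frac1{\sqrt{N_0}}\mathbf H\\ \frac1{\sqrt{E_s}}\mathbf I_N\end{bmatrix}=\mathbf Q_{\mathrm a}\mathbf L_{\mathrm a}$ be the thin QL decomposition of the augmented channel ($\mathbf Q_{\mathrm a}^\dagger\mathbf Q_{\mathrm a}=\mathbf I_N$, $\mathbf L_{\mathrm a}$ lower triangular with positive real diagonal). Let $\mathbf S_{\mathrm a}$ be the lower right $(N-\nu)\times(N-\nu)$ block of $\mathbf L_{\mathrm a}$, $\mathbf\Sigma_{\mathrm a}=\operatorname{diag}(\mathbf S_{\mathrm a}^{-1}\mathbf S_{\mathrm a}^{-\dagger})^{-1/2}$, and let $\mathbf L_{\mathrm{ap}}=\begin{bmatrix}\mathbf I_\nu&\mathbf 0\\ \mathbf 0&\mathbf\Sigma_{\mathrm a}\mathbf S_{\mathrm a}^{-1}\end{bmatrix}\mathbf L_{\mathrm a}$ be the punctured augmented matrix. Let $\mathbf W_{\mathrm{mmse}}=\mathbf H^\dagger\bigl(\mathbf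 H\mathbf H^\dagger+\tfrac{N_0}{E_s}\mathbf I_M\bigr)^{-1}$. Then $\mathbf L_{\mathrm{ap}}$ is punctured of order $\nu$ with positive real diagonal, and, for the metric $$2\,\mathrm{Re}(\mathbf y^\dagger\mathbf F\mathbf x)-\mathbf x^\dagger\mathbf G\mathbf x+\tfrac1{E_s}\mathbf x^\dagger\mathbf x,$$ the bound $I_{\mathrm{LB}}$ is maximized, over all $\mathbf F\in\mathbb C^{M\times N}$ and all positive semidefinite $\mathbf G=\mathbf J^\dagger\mathbf J$ with $\mathbf J$ punctured of order $\nu$, exactly at $$\mathbf G_{\mathrm{opt}}=\mathbf L_{\mathrm{ap}}^\dagger\mathbf L_{\mathrm{ap}},\qquad \mathbf F_{\mathrm{opt}}=\mathbf W_{\mathrm{mmse}}^\dagger\mathbf G_{\mathrm{opt}}.$$ These are the parameters of the augmented WL detector (AWLD), so the lower bound $N\log E_s+\log\det(\mathbf L_{\mathrm{ap}}^\dagger\mathbf L_{\mathrm{ap}})$ that it attains is the optimal value. Moreover, the AWLD coincides with the AIR partial marginalization (AIR-PM) detector: among all $\mathbf F$ and all $\mathbf G$ such that $\mathbf G+\tfrac1{E_s}\mathbf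 I=\mathbf J^\dagger\mathbf J$ with $\mathbf J$ punctured of order $\nu$, the bound $I_{\mathrm{LB}}$ of the metric $2\,\mathrm{Re}(\mathbf y^\dagger\mathbf F\mathbf x)-\mathbf x^\dagger\mathbf G\mathbf x$ is maximized exactly at $\mathbf F_{\mathrm{opt}}$ and $\mathbf G_{\mathrm{opt}}-\tfrac1{E_s}\mathbf I$, and with these parameters that metric equals the AWLD metric. -/

import Mathlib

open scoped ENNReal Matrix

noncomputable section

namespace Mimo

open MeasureTheory Matrix
open scoped ComplexOrder

/-- The circularly symmetric complex Gaussian law `CN(0, v I_n)` on `ℂⁿ` (for `v > 0`), given by its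
density `(π v)⁻ⁿ exp (-‖x‖² / v)` with respect to Lebesgue measure, `‖·‖` the Euclidean norm. -/
def complexGaussian (n : ℕ) (v : ℝ) : Measure (Fin n → ℂ) :=
  (volume : Measure (Fin n → ℂ)).withDensity fun x =>
    ENNReal.ofReal (((Real.pi * v) ^ n)⁻¹ * Real.exp (-(∑ i, ‖x i‖ ^ 2) / v))

/-- The joint law of `(y, x)` for the channel `y = H x + z`, where `x ∼ CN(0, Es I)` and
`z ∼ CN(0, N0 I)` are independent. -/
def channelLaw {M N : ℕ} (H : Matrix (Fin M) (Fin N) ℂ) (Es N0 : ℝ) :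
    Measure ((Fin M → ℂ) × (Fin N → ℂ)) :=
  ((complexGaussian N Es).prod (complexGaussian M N0)).map
    fun q : (Fin N → ℂ) × (Fin M → ℂ) => (H *ᵥ q.1 + q.2, q.1)

/-- Expectation of an extended real random variable, `E[f] = E[f⁺] - E[f⁻]` in `[-∞, ∞]`. -/
def extExpectation {Ω : Type*} [MeasurableSpace Ω] (P : Measure Ω) (f : Ω → EReal) : EReal :=
  ((∫⁻ ω, (f ω).toENNReal ∂P : ℝ≥0∞) : EReal) - ((∫⁻ ω, (-f ω).toENNReal ∂P : ℝ≥0∞) : EReal)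

/-- The (possibly infinite) output weight `p(y) = ∫ p(y|x) p(x) dx` of the detection model
`p(y|x) = exp (μ(y|x))`, with Gaussian prior `x ∼ CN(0, Es I)`. -/
def outputWeight {M N : ℕ} (Es : ℝ) (metric : (Fin M → ℂ) → (Fin N → ℂ) → ℝ) (y : Fin M → ℂ) :
    ℝ≥0∞ :=
  ∫⁻ x, ENNReal.ofReal (Real.exp (metric y x)) ∂(complexGaussian N Es)

/-- The lower bound `E_{Y,X}[log p(y|x)] - E_Y[log p(y)]` on the achievable information rate of the
detection model `p(y|x) = exp (μ(y|x))`; the expectations are over the true channel law. The value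
is `-∞` when `p(y) = ∞`. -/
def airLowerBound {M N : ℕ} (H : Matrix (Fin M) (Fin N) ℂ) (Es N0 : ℝ)
    (metric : (Fin M → ℂ) → (Fin N → ℂ) → ℝ) : EReal :=
  extExpectation (channelLaw H Es N0)
      (fun q => ((Real.log (Real.exp (metric q.1 q.2)) : ℝ) : EReal))
    - extExpectation (channelLaw H Es N0).fst (fun y => ENNReal.log (outputWeight Es metric y))

/-- The metric `2 Re (yᴴ F x) - xᴴ G x` (`G` Hermitian). -/
def shorteningMetric {M N : ℕ} (F : Matrix (Fin M) (Fin N) ℂ) (G : Matrix (Fin N) (Fin N) ℂ)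
    (y : Fin M → ℂ) (x : Fin N → ℂ) : ℝ :=
  2 * (star y ⬝ᵥ (F *ᵥ x)).re - (star x ⬝ᵥ (G *ᵥ x)).re

/-- The metric `2 Re (yᴴ F x) - xᴴ G x + xᴴ x / Es` (`G` Hermitian). -/
def modifiedMetric {M N : ℕ} (Es : ℝ) (F : Matrix (Fin M) (Fin N) ℂ)
    (G : Matrix (Fin N) (Fin N) ℂ) (y : Fin M → ℂ) (x : Fin N → ℂ) : ℝ :=
  2 * (star y ⬝ᵥ (F *ᵥ x)).re - (star x ⬝ᵥ (G *ᵥ x)).re + 1 / Es * (star x ⬝ᵥ x).re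

/-- Entries strictly above the main diagonal vanish. -/
def IsLowerTriangular {N : ℕ} (L : Matrix (Fin N) (Fin N) ℂ) : Prop :=
  ∀ i j, i < j → L i j = 0

/-- Every diagonal entry is real and positive. -/
def HasPosDiag {N : ℕ} (L : Matrix (Fin N) (Fin N) ℂ) : Prop :=
  ∀ i, 0 < (L i i).re ∧ (L i i).im = 0

/-- Punctured lower-triangular structure of order `ν`: `J = [J₁ 0; J₂ J₃]` with `J₁` lower
triangular of size `ν × ν` and `J₃` diagonal. -/
def IsPunctured {N : ℕ} (ν : ℕ) (J : Matrix (Fin N) (Fin N) ℂ) : Prop :=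
  IsLowerTriangular J ∧ ∀ i j : Fin N, ν ≤ (j : ℕ) → j < i → J i j = 0

/-- The augmented channel `[H / √N0 ; I / √Es]`. -/
def augmentedChannel {M N : ℕ} (H : Matrix (Fin M) (Fin N) ℂ) (Es N0 : ℝ) :
    Matrix (Fin M ⊕ Fin N) (Fin N) ℂ :=
  Matrix.fromRows (((1 / Real.sqrt N0 : ℝ) : ℂ) • H)
    (((1 / Real.sqrt Es : ℝ) : ℂ) • (1 : Matrix (Fin N) (Fin N) ℂ))

/-- `A = Q L` is a thin QL decomposition: `Q` has orthonormal columns and `L` is lower triangular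
with positive real diagonal. -/
structure IsThinQL {m : Type*} [Fintype m] {N : ℕ} (A Q : Matrix m (Fin N) ℂ)
    (L : Matrix (Fin N) (Fin N) ℂ) : Prop where
  eq_mul : A = Q * L
  orthonormal : Qᴴ * Q = 1
  lower : IsLowerTriangular L
  posDiag : HasPosDiag L

/-- The MMSE filter `Hᴴ (H Hᴴ + (N0 / Es) I)⁻¹`. -/
def mmseFilter {M N : ℕ} (H : Matrix (Fin M) (Fin N) ℂ) (Es N0 : ℝ) :
    Matrix (Fin N) (Fin M) ℂ :=
  Hᴴ * (H * Hᴴ + ((N0 / Es : ℝ) : ℂ) • (1 : Matrix (Fin M) (Fin M) ℂ))⁻¹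

/-- The lower right `k × k` block `S` of `L = [P 0; R S]`. -/
def childBlock {ν k : ℕ} (L : Matrix (Fin (ν + k)) (Fin (ν + k)) ℂ) :
    Matrix (Fin k) (Fin k) ℂ :=
  L.submatrix (Fin.natAdd ν) (Fin.natAdd ν)

/-- `diag (S⁻¹ S⁻ᴴ) ^ (-1/2)`. -/
def rowNormalizer {k : ℕ} (S : Matrix (Fin k) (Fin k) ℂ) : Matrix (Fin k) (Fin k) ℂ :=
  Matrix.diagonal fun i => (((Real.sqrt ((S⁻¹ * (S⁻¹)ᴴ) i i).re)⁻¹ : ℝ) : ℂ)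

/-- The puncturing matrix `[I_ν 0; 0 Σ S⁻¹]`, with `S` the lower right block of `L` and
`Σ = diag (S⁻¹ S⁻ᴴ) ^ (-1/2)`. -/
def puncturingMatrix {ν k : ℕ} (L : Matrix (Fin (ν + k)) (Fin (ν + k)) ℂ) :
    Matrix (Fin (ν + k)) (Fin (ν + k)) ℂ :=
  Matrix.reindex finSumFinEquiv finSumFinEquiv
    (Matrix.fromBlocks (1 : Matrix (Fin ν) (Fin ν) ℂ) 0 0
      (rowNormalizer (childBlock L) * (childBlock L)⁻¹))

/-- The punctured matrix `W L`, `W` being the puncturing matrix of `L`. -/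
def puncturedMatrix {ν k : ℕ} (L : Matrix (Fin (ν + k)) (Fin (ν + k)) ℂ) :
    Matrix (Fin (ν + k)) (Fin (ν + k)) ℂ :=
  puncturingMatrix L * L

/-- `G` is positive semidefinite with a factorization `G = Jᴴ J` whose factor `J` is punctured of
order `ν`. -/
def HasPuncturedFactor {N : ℕ} (ν : ℕ) (G : Matrix (Fin N) (Fin N) ℂ) : Prop :=
  G.PosSemidef ∧ ∃ J, IsPunctured ν J ∧ G = Jᴴ * J

/-- `(F, G)` maximizes the rate lower bound of the model with metric
`2 Re (yᴴ F x) - xᴴ G x + xᴴ x / Es`, over all `F` and all positive semidefinite `G` with punctured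
factors of order `ν`. -/
def IsOptimalModified {M N : ℕ} (ν : ℕ) (H : Matrix (Fin M) (Fin N) ℂ) (Es N0 : ℝ)
    (F : Matrix (Fin M) (Fin N) ℂ) (G : Matrix (Fin N) (Fin N) ℂ) : Prop :=
  HasPuncturedFactor ν G ∧ ∀ F' G', HasPuncturedFactor ν G' →
    airLowerBound H Es N0 (modifiedMetric Es F' G') ≤ airLowerBound H Es N0 (modifiedMetric Es F G)

/-- `(F, G)` are parameters of the AIR-PM detector of order `ν`: they maximize the rate lower bound
of the model with metric `2 Re (yᴴ F x) - xᴴ G x`, over all `F` and all `G` for which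
`G + I / Es` has punctured factors of order `ν`. -/
def IsAirPM {M N : ℕ} (ν : ℕ) (H : Matrix (Fin M) (Fin N) ℂ) (Es N0 : ℝ)
    (F : Matrix (Fin M) (Fin N) ℂ) (G : Matrix (Fin N) (Fin N) ℂ) : Prop :=
  HasPuncturedFactor ν (G + ((1 / Es : ℝ) : ℂ) • 1) ∧
    ∀ F' G', HasPuncturedFactor ν (G' + ((1 / Es : ℝ) : ℂ) • 1) →
      airLowerBound H Es N0 (shorteningMetric F' G') ≤
        airLowerBound H Es N0 (shorteningMetric F G)

end Mimo

end

open Mimo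

/-!
The rate lower bound of a quadratic metric is explicit. For positive definite `G`, the output weight
`p(y)` is a complex Gaussian integral (`lintegral_exp_quadratic`), and all expectations reduce to the
second-order statistics of the channel (`hasCrossCorrelation_channelLaw`). This gives
`gaussianRate`. For singular `G` the output weight is infinite
(`lintegral_exp_quadratic_of_singular`), so the bound is `-∞` and `G` is not a maximizer.

Completing the square in `F` (`gaussianRate_eq`) shows that the rate is
`N + N log Es + log det G - tr (G (LᴴL)⁻¹)` minus a positive definite quadratic form in `F - Wᴴ G`,
where `W` is the MMSE filter and `L` the triangular factor of the augmented channel, whose inverse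
Gram matrix `(LᴴL)⁻¹` is the MMSE error covariance (`mmse_error_eq_inv`). So `F = Wᴴ G` is the
unique best choice for each `G`.

It remains to maximize `log det (JᴴJ) - ‖J L⁻¹‖²` over punctured `J`. Let `V` be the puncturing
matrix, so that the punctured matrix is `P = V L`. The rows of `V` are unit vectors, and the `i`-th
row of `D L⁻¹` is orthogonal to the `i`-th row of `V` for every punctured `D` with zero diagonal
(`mul_inv_mul_puncturingMatrix_diag`). Writing `J = diag c * P + D` with such a `D`, the objective is
`log det (PᴴP) + ∑ (log |cᵢ|² - |cᵢ|²) - ‖D L⁻¹‖²`. As `log t - t ≤ -1` with equality only at `t = 1`,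
it is maximal exactly when `|cᵢ| = 1` and `D = 0`, that is, when `JᴴJ = PᴴP`
(`log_det_sub_trace_le`).

The second criterion is the first one with `G` shifted by `I / Es`
(`isAirPM_iff_isOptimalModified`).
-/

namespace Mimo
open MeasureTheory Matrix
open scoped ComplexOrder

/-! ### The complex Gaussian law and its second moments -/

/-- The density of the one-dimensional law `CN(0, v)`. -/
noncomputable def normalDensity (v : ℝ) (z : ℂ) : ℝ :=
  (Real.pi * v)⁻¹ * Real.exp (-‖z‖ ^ 2 / v)

/-- The one-dimensional circularly symmetric complex Gaussian law `CN(0, v)`. -/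
noncomputable def complexNormal (v : ℝ) : Measure ℂ :=
  volume.withDensity fun z => ENNReal.ofReal (normalDensity v z)

lemma normalDensity_nonneg {v : ℝ} (hv : 0 < v) (z : ℂ) : 0 ≤ normalDensity v z := by
  unfold normalDensity; positivity

@[fun_prop]
lemma continuous_normalDensity (v : ℝ) : Continuous (normalDensity v) := by
  unfold normalDensity; fun_prop

lemma integral_normalDensity {v : ℝ} (hv : 0 < v) : ∫ z, normalDensity v z = 1 := by
  have h := Complex.integral_rpow_mul_exp_neg_mul_rpow (p := 2) (q := 0) (b := v⁻¹)
    (by norm_num) (by norm_num) (by positivity)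
  norm_num at h
  have e : ∀ z : ℂ, normalDensity v z = (Real.pi * v)⁻¹ * Real.exp (-(v⁻¹ * ‖z‖ ^ 2)) := by
    intro z; unfold normalDensity; congr 2; field_simp
  simp_rw [e, integral_const_mul, h, Real.rpow_neg_one]
  field_simp

lemma integral_normSq_mul_normalDensity {v : ℝ} (hv : 0 < v) :
    ∫ z, ‖z‖ ^ 2 * normalDensity v z = v := by
  have h := Complex.integral_rpow_mul_exp_neg_mul_rpow (p := 2) (q := 2) (b := v⁻¹)
    (by norm_num) (by norm_num) (by positivity)
  norm_num at h
  have e : ∀ z : ℂ, ‖z‖ ^ 2 * normalDensity v z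
      = (Real.pi * v)⁻¹ * (‖z‖ ^ 2 * Real.exp (-(v⁻¹ * ‖z‖ ^ 2))) := by
    intro z; unfold normalDensity
    rw [show -‖z‖ ^ 2 / v = -(v⁻¹ * ‖z‖ ^ 2) by field_simp]; ring
  simp_rw [e, integral_const_mul, h]
  field_simp

lemma integrable_normalDensity {v : ℝ} (hv : 0 < v) : Integrable (normalDensity v) := by
  by_contra h
  have := integral_normalDensity hv
  rw [integral_undef h] at this
  norm_num at this

lemma integrable_normSq_mul_normalDensity {v : ℝ} (hv : 0 < v) :
    Integrable fun z => ‖z‖ ^ 2 * normalDensity v z := by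
  by_contra h
  have := integral_normSq_mul_normalDensity hv
  rw [integral_undef h] at this
  exact hv.ne this

lemma isProbabilityMeasure_complexNormal {v : ℝ} (hv : 0 < v) :
    IsProbabilityMeasure (complexNormal v) := by
  refine ⟨?_⟩
  rw [complexNormal, withDensity_apply _ MeasurableSet.univ, Measure.restrict_univ,
    ← ofReal_integral_eq_lintegral_ofReal (integrable_normalDensity hv)
      (.of_forall (normalDensity_nonneg hv)), integral_normalDensity hv]
  simp

/-- `CN(0, v I_n)` is the law of `n` independent `CN(0, v)` coordinates. -/
lemma complexGaussian_eq_pi (n : ℕ) {v : ℝ} (hv : 0 < v) :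
    complexGaussian n v = Measure.pi fun _ => complexNormal v := by
  have := isProbabilityMeasure_complexNormal hv
  refine (Measure.pi_eq fun s hs => ?_).symm
  have hd : ∀ x : Fin n → ℂ, ((Real.pi * v) ^ n)⁻¹ * Real.exp (-(∑ i, ‖x i‖ ^ 2) / v)
      = ∏ i, normalDensity v (x i) := by
    intro x
    simp only [normalDensity, Finset.prod_mul_distrib, ← Real.exp_sum, Finset.prod_const,
      Finset.card_univ, Fintype.card_fin, inv_pow, ← Finset.sum_div, Finset.sum_neg_distrib]
  have hint : ∀ i, Integrable (normalDensity v) (volume.restrict (s i)) :=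
    fun i => (integrable_normalDensity hv).restrict
  simp only [complexGaussian, hd, complexNormal]
  rw [withDensity_apply _ (MeasurableSet.univ_pi hs), volume_pi, Measure.restrict_pi_pi,
    ← ofReal_integral_eq_lintegral_ofReal (Integrable.fintype_prod hint)
      (.of_forall fun x => Finset.prod_nonneg fun i _ =>
        normalDensity_nonneg hv _),
    integral_fintype_prod_eq_prod (fun _ => normalDensity v), ENNReal.ofReal_prod_of_nonneg
      fun i _ => integral_nonneg (normalDensity_nonneg hv)]
  refine Finset.prod_congr rfl fun i _ => ?_
  rw [withDensity_apply _ (hs i), ofReal_integral_eq_lintegral_ofReal (hint i)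
      (.of_forall (normalDensity_nonneg hv))]

lemma isProbabilityMeasure_complexGaussian (n : ℕ) {v : ℝ} (hv : 0 < v) :
    IsProbabilityMeasure (complexGaussian n v) := by
  have := isProbabilityMeasure_complexNormal hv
  rw [complexGaussian_eq_pi n hv]
  infer_instance

lemma integral_complexNormal {E : Type*} [NormedAddCommGroup E] [NormedSpace ℝ E] {v : ℝ}
    (hv : 0 < v) (f : ℂ → E) :
    ∫ z, f z ∂complexNormal v = ∫ z, normalDensity v z • f z := by
  rw [complexNormal, integral_withDensity_eq_integral_toReal_smul (by fun_prop)
    (.of_forall fun _ => ENNReal.ofReal_lt_top)]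
  simp_rw [ENNReal.toReal_ofReal (normalDensity_nonneg hv _)]

lemma integrable_complexNormal_iff {E : Type*} [NormedAddCommGroup E] [NormedSpace ℝ E] {v : ℝ}
    (hv : 0 < v) {f : ℂ → E} :
    Integrable f (complexNormal v) ↔ Integrable fun z => normalDensity v z • f z := by
  rw [complexNormal, integrable_withDensity_iff_integrable_smul' (by fun_prop)
    (.of_forall fun _ => ENNReal.ofReal_lt_top)]
  simp_rw [ENNReal.toReal_ofReal (normalDensity_nonneg hv _)]

lemma memLp_complexNormal {v : ℝ} (hv : 0 < v) : MemLp (fun z : ℂ => z) 2 (complexNormal v) := by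
  rw [memLp_two_iff_integrable_sq_norm (by fun_prop), integrable_complexNormal_iff hv]
  simpa only [smul_eq_mul, mul_comm] using integrable_normSq_mul_normalDensity hv

lemma integral_id_complexNormal {v : ℝ} (hv : 0 < v) : ∫ z, z ∂complexNormal v = 0 := by
  rw [integral_complexNormal hv]
  -- the integrand is odd
  have h := integral_neg_eq_self (fun z : ℂ => normalDensity v z • z) volume
  simp only [normalDensity, norm_neg, smul_neg, integral_neg] at h ⊢
  exact self_eq_neg.mp h.symm

lemma integral_mul_star_complexNormal {v : ℝ} (hv : 0 < v) :
    ∫ z : ℂ, z * star z ∂complexNormal v = v := by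
  have e : ∀ z : ℂ, normalDensity v z • (z * star z) = ((‖z‖ ^ 2 * normalDensity v z : ℝ) : ℂ) := by
    intro z
    rw [Complex.star_def, Complex.mul_conj']
    simp [mul_comm]
  rw [integral_complexNormal hv]
  simp_rw [e]
  rw [integral_complex_ofReal, integral_normSq_mul_normalDensity hv]

lemma memLp_complexGaussian {n : ℕ} {v : ℝ} (hv : 0 < v) (i : Fin n) :
    MemLp (fun x : Fin n → ℂ => x i) 2 (complexGaussian n v) := by
  have := isProbabilityMeasure_complexNormal hv
  rw [complexGaussian_eq_pi n hv]
  exact (memLp_complexNormal hv).comp_measurePreserving (measurePreserving_eval _ i)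

lemma integral_eval_complexGaussian {n : ℕ} {v : ℝ} (hv : 0 < v) (i : Fin n) :
    ∫ x, x i ∂complexGaussian n v = 0 := by
  have := isProbabilityMeasure_complexNormal hv
  rw [complexGaussian_eq_pi n hv, integral_eval, integral_id_complexNormal hv]

lemma integral_mul_star_complexGaussian {n : ℕ} {v : ℝ} (hv : 0 < v) (i j : Fin n) :
    ∫ x, x i * star (x j) ∂complexGaussian n v = if i = j then (v : ℂ) else 0 := by
  have := isProbabilityMeasure_complexNormal hv
  split_ifs with hij
  · subst hij
    rw [complexGaussian_eq_pi n hv,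
      integral_comp_eval (X := fun _ : Fin n => ℂ) (i := i) (f := fun z : ℂ => z * star z)
        (by fun_prop),
      integral_mul_star_complexNormal hv]
  · have hind : ProbabilityTheory.IndepFun (fun x : Fin n → ℂ => x i)
        (fun x : Fin n → ℂ => star (x j)) (complexGaussian n v) := by
      rw [complexGaussian_eq_pi n hv]
      exact ((ProbabilityTheory.iIndepFun_pi (X := fun _ z => z)
        (fun _ => aemeasurable_id)).indepFun hij).comp measurable_id
        continuous_star.measurable
    rw [hind.integral_fun_mul_eq_mul_integral (continuous_apply i).aestronglyMeasurable
      (continuous_star.comp (continuous_apply j)).aestronglyMeasurable,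
      integral_eval_complexGaussian hv, zero_mul]

/-! ### Complex Gaussian integrals -/

lemma star_dotProduct_self_re {n : ℕ} (x : Fin n → ℂ) :
    (star x ⬝ᵥ x).re = ∑ i, ‖x i‖ ^ 2 := by
  simp [dotProduct, Complex.conj_mul', ← Complex.ofReal_pow]

/-- The complex linear change of variables `x ↦ A x` has real Jacobian `|det A|²`. -/
lemma lintegral_comp_mulVec {n : ℕ} (A : Matrix (Fin n) (Fin n) ℂ) (hA : A.det ≠ 0)
    {f : (Fin n → ℂ) → ℝ≥0∞} (hf : Measurable f) :
    ∫⁻ x, f (A *ᵥ x) = ENNReal.ofReal (‖A.det‖ ^ 2)⁻¹ * ∫⁻ x, f x := by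
  set g : (Fin n → ℂ) →ₗ[ℝ] (Fin n → ℂ) := (Matrix.toLin' A).restrictScalars ℝ with hg
  have hdet : LinearMap.det g = ‖A.det‖ ^ 2 := by
    rw [hg, LinearMap.det_restrictScalars, LinearMap.det_toLin', Algebra.norm_complex_eq]
    simp [Complex.normSq_eq_norm_sq]
  have hg0 : LinearMap.det g ≠ 0 := by
    rw [hdet]; positivity
  have hgm : Measurable g := g.continuous_of_finiteDimensional.measurable
  have h := lintegral_map (μ := volume) hf hgm
  rw [Measure.map_linearMap_addHaar_eq_smul_addHaar _ hg0, lintegral_smul_measure, hdet,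
    abs_of_nonneg (by positivity)] at h
  rw [← smul_eq_mul, h]
  rfl

lemma lintegral_exp_neg_normSq (n : ℕ) :
    ∫⁻ x : Fin n → ℂ, ENNReal.ofReal (Real.exp (-∑ i, ‖x i‖ ^ 2))
      = ENNReal.ofReal (Real.pi ^ n) := by
  have h := (isProbabilityMeasure_complexGaussian n one_pos).measure_univ
  rw [complexGaussian, withDensity_apply _ MeasurableSet.univ, Measure.restrict_univ] at h
  simp_rw [mul_one, div_one, ENNReal.ofReal_mul (inv_nonneg.mpr (pow_nonneg Real.pi_pos.le n))] at h
  rw [lintegral_const_mul _ (by fun_prop), ENNReal.ofReal_inv_of_pos (by positivity)] at h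
  rw [← mul_one (ENNReal.ofReal (Real.pi ^ n)), ← h, ← mul_assoc,
    ENNReal.mul_inv_cancel (by simp [Real.pi_pos]) ENNReal.ofReal_ne_top, one_mul]

lemma exists_eq_conjTranspose_mul_self {n : ℕ} {G : Matrix (Fin n) (Fin n) ℂ} (hG : G.PosDef) :
    ∃ A : Matrix (Fin n) (Fin n) ℂ, A.det ≠ 0 ∧ G = Aᴴ * A := by
  open scoped MatrixOrder in
  obtain ⟨A, hA⟩ := CStarAlgebra.nonneg_iff_eq_star_mul_self.mp hG.posSemidef.nonneg
  refine ⟨A, fun h => ?_, hA⟩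
  have := hG.det_pos
  rw [hA, det_mul, h, mul_zero] at this
  exact lt_irrefl _ this

lemma re_dotProduct_conjTranspose_mul_self {n m : ℕ} (A : Matrix (Fin m) (Fin n) ℂ)
    (x : Fin n → ℂ) : (star x ⬝ᵥ ((Aᴴ * A) *ᵥ x)).re = ∑ i, ‖(A *ᵥ x) i‖ ^ 2 := by
  rw [← star_dotProduct_self_re, star_mulVec, ← mulVec_mulVec, dotProduct_mulVec]

/-- Completing the square around the mode `G⁻¹ w`. -/
lemma complete_square {n : ℕ} {G : Matrix (Fin n) (Fin n) ℂ} (hG : G.PosDef) (w x : Fin n → ℂ) :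
    2 * (star w ⬝ᵥ x).re - (star x ⬝ᵥ (G *ᵥ x)).re
      = (star w ⬝ᵥ (G⁻¹ *ᵥ w)).re
        - (star (x - G⁻¹ *ᵥ w) ⬝ᵥ (G *ᵥ (x - G⁻¹ *ᵥ w))).re := by
  have hdet : IsUnit G.det := (isUnit_iff_isUnit_det _).mp hG.isUnit
  have hGi : (G⁻¹)ᴴ = G⁻¹ := hG.inv.isHermitian.eq
  have e1 : G *ᵥ (G⁻¹ *ᵥ w) = w := by rw [mulVec_mulVec, mul_nonsing_inv _ hdet, one_mulVec]
  have e2 : star (G⁻¹ *ᵥ w) ⬝ᵥ (G *ᵥ x) = star w ⬝ᵥ x := by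
    rw [star_mulVec, hGi, dotProduct_mulVec, vecMul_vecMul, nonsing_inv_mul _ hdet, vecMul_one]
  have e3 : star (G⁻¹ *ᵥ w) ⬝ᵥ w = star w ⬝ᵥ (G⁻¹ *ᵥ w) := by
    rw [star_mulVec, hGi, dotProduct_mulVec]
  have e4 : (star x ⬝ᵥ w).re = (star w ⬝ᵥ x).re := by
    rw [← star_star (star x ⬝ᵥ w), ← star_dotProduct_star]; simp [dotProduct_comm]
  rw [mulVec_sub, e1, star_sub, sub_dotProduct, dotProduct_sub, dotProduct_sub, e2, e3]
  simp only [Complex.sub_re, e4]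
  ring

/-- The complex Gaussian integral with a linear term. -/
lemma lintegral_exp_quadratic {n : ℕ} {G : Matrix (Fin n) (Fin n) ℂ} (hG : G.PosDef)
    (w : Fin n → ℂ) :
    ∫⁻ x, ENNReal.ofReal (Real.exp (2 * (star w ⬝ᵥ x).re - (star x ⬝ᵥ (G *ᵥ x)).re))
      = ENNReal.ofReal (Real.exp (star w ⬝ᵥ (G⁻¹ *ᵥ w)).re * (G.det.re⁻¹ * Real.pi ^ n)) := by
  obtain ⟨A, hA, hGA⟩ := exists_eq_conjTranspose_mul_self hG
  have hdet : G.det.re = ‖A.det‖ ^ 2 := by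
    rw [hGA, det_mul, det_conjTranspose, Complex.star_def, Complex.conj_mul', ← Complex.ofReal_pow,
      Complex.ofReal_re]
  have hc : Continuous fun x : Fin n → ℂ => (star x ⬝ᵥ (G *ᵥ x)).re := by
    unfold dotProduct mulVec dotProduct; simp; fun_prop
  simp_rw [complete_square hG, sub_eq_add_neg _ (Complex.re _), Real.exp_add,
    ENNReal.ofReal_mul (Real.exp_nonneg _)]
  rw [lintegral_const_mul _ (by fun_prop)]
  congr 1
  rw [lintegral_sub_right_eq_self
    (fun x => ENNReal.ofReal (Real.exp (-(star x ⬝ᵥ (G *ᵥ x)).re)))]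
  simp_rw [hdet, hGA, re_dotProduct_conjTranspose_mul_self]
  rw [lintegral_comp_mulVec A hA
    (f := fun x => ENNReal.ofReal (Real.exp (-∑ i, ‖x i‖ ^ 2))) (by fun_prop),
    lintegral_exp_neg_normSq, ENNReal.ofReal_mul (by positivity)]

/-- For a singular form the Gaussian integral diverges: the integrand dominates those of the forms
`G + ε I`, whose integrals are of order `1 / det (G + ε I)`. -/
lemma lintegral_exp_quadratic_of_singular {n : ℕ} {G : Matrix (Fin n) (Fin n) ℂ}
    (hG : G.PosSemidef) (hdet : G.det = 0) (w : Fin n → ℂ) :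
    ∫⁻ x, ENNReal.ofReal (Real.exp (2 * (star w ⬝ᵥ x).re - (star x ⬝ᵥ (G *ᵥ x)).re)) = ⊤ := by
  -- `D ε = G + ε I` is positive definite, and `det (D ε)` tends to `det G = 0` as `ε → 0`.
  let D : ℝ → Matrix (Fin n) (Fin n) ℂ := fun ε => G + (ε : ℂ) • 1
  have hD : ∀ ε, 0 < ε → (D ε).PosDef := fun ε hε =>
    PosDef.posSemidef_add hG (PosDef.one.smul (by exact_mod_cast hε))
  have hpos : ∀ ε, 0 < ε → 0 < (D ε).det.re := fun ε hε =>
    (Complex.lt_def.mp (hD ε hε).det_pos).1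
  have hcont : Continuous fun ε => (D ε).det.re := by
    have : Continuous D := by fun_prop
    exact Complex.continuous_re.comp this.matrix_det
  have hlim : Filter.Tendsto (fun ε => (D ε).det.re) (nhdsWithin 0 (Set.Ioi 0))
      (nhdsWithin 0 (Set.Ioi 0)) := by
    refine tendsto_nhdsWithin_iff.mpr ⟨?_, ?_⟩
    · have := (hcont.tendsto 0).mono_left (nhdsWithin_le_nhds (s := Set.Ioi (0 : ℝ)))
      simpa [D, hdet] using this
    · filter_upwards [self_mem_nhdsWithin] with ε hε using hpos ε hε
  have hlim2 : Filter.Tendsto (fun ε => ENNReal.ofReal ((D ε).det.re⁻¹ * Real.pi ^ n))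
      (nhdsWithin 0 (Set.Ioi 0)) (nhds ⊤) :=
    ENNReal.tendsto_ofReal_atTop.comp
      ((tendsto_inv_nhdsGT_zero.comp hlim).atTop_mul_const (by positivity))
  refine top_le_iff.mp (le_of_tendsto hlim2 ?_)
  filter_upwards [self_mem_nhdsWithin] with ε hε
  have hε' : 0 < ε := hε
  calc ENNReal.ofReal ((D ε).det.re⁻¹ * Real.pi ^ n)
      ≤ ENNReal.ofReal (Real.exp (star w ⬝ᵥ ((D ε)⁻¹ *ᵥ w)).re
          * ((D ε).det.re⁻¹ * Real.pi ^ n)) := by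
        refine ENNReal.ofReal_le_ofReal (le_mul_of_one_le_left ?_ ?_)
        · have := hpos ε hε'; positivity
        · exact Real.one_le_exp ((hD ε hε').inv.posSemidef.re_dotProduct_nonneg w)
    _ = _ := (lintegral_exp_quadratic (hD ε hε') w).symm
    _ ≤ _ := by
        refine lintegral_mono fun x => ENNReal.ofReal_le_ofReal (Real.exp_le_exp.mpr ?_)
        have h0 : 0 ≤ ε * ∑ i, ‖x i‖ ^ 2 := by positivity
        simp only [D, add_mulVec, smul_mulVec, one_mulVec, dotProduct_add, dotProduct_smul,
          Complex.add_re, smul_eq_mul, Complex.re_ofReal_mul, star_dotProduct_self_re]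
        linarith

/-! ### Second-order statistics of the channel and value of the rate lower bound -/

/-- The random vectors `v`, `u` have cross-correlation matrix `C = E[v uᴴ]`, all entries of `v uᴴ`
being integrable. -/
def HasCrossCorrelation {Ω : Type*} [MeasurableSpace Ω] (P : Measure Ω) {m n : ℕ}
    (v : Ω → Fin n → ℂ) (u : Ω → Fin m → ℂ) (C : Matrix (Fin n) (Fin m) ℂ) : Prop :=
  ∀ j i, Integrable (fun ω => v ω j * star (u ω i)) P ∧ ∫ ω, v ω j * star (u ω i) ∂P = C j i

namespace HasCrossCorrelation

variable {Ω : Type*} [MeasurableSpace Ω] {P : Measure Ω} {l m n : ℕ}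
  {v v' : Ω → Fin n → ℂ} {u : Ω → Fin m → ℂ} {C C' : Matrix (Fin n) (Fin m) ℂ}

lemma symm (h : HasCrossCorrelation P v u C) : HasCrossCorrelation P u v Cᴴ := by
  intro i j
  have e : ∀ ω, u ω i * star (v ω j) = (starRingEnd ℂ) (v ω j * star (u ω i)) := by
    intro ω; simp [mul_comm]
  simp_rw [e]
  refine ⟨(Complex.conjCLE : ℂ →L[ℝ] ℂ).integrable_comp (h j i).1, ?_⟩
  rw [integral_conj, (h j i).2]
  simp

lemma mulVec (h : HasCrossCorrelation P v u C) (B : Matrix (Fin l) (Fin n) ℂ) :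
    HasCrossCorrelation P (fun ω => B *ᵥ v ω) u (B * C) := by
  intro j i
  have e : ∀ ω, (B *ᵥ v ω) j * star (u ω i) = ∑ k, B j k * (v ω k * star (u ω i)) := by
    intro ω; simp [Matrix.mulVec, dotProduct, Finset.sum_mul, mul_assoc]
  simp_rw [e]
  have hk : ∀ k, Integrable (fun ω => B j k * (v ω k * star (u ω i))) P :=
    fun k => (h k i).1.const_mul _
  refine ⟨integrable_finsetSum _ fun k _ => hk k, ?_⟩
  rw [integral_finsetSum _ fun k _ => hk k, mul_apply]
  simp_rw [integral_const_mul, (h _ i).2]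

lemma add (h : HasCrossCorrelation P v u C) (h' : HasCrossCorrelation P v' u C') :
    HasCrossCorrelation P (fun ω => v ω + v' ω) u (C + C') := by
  intro j i
  simp only [Pi.add_apply, add_mul, Matrix.add_apply]
  exact ⟨(h j i).1.add (h' j i).1, by rw [integral_add (h j i).1 (h' j i).1, (h j i).2, (h' j i).2]⟩

/-- `E[uᴴ A v] = tr (A C)`, with integrability. -/
lemma integrable_sesquilinear (h : HasCrossCorrelation P v u C) (A : Matrix (Fin m) (Fin n) ℂ) :
    Integrable (fun ω => star (u ω) ⬝ᵥ (A *ᵥ v ω)) P ∧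
      ∫ ω, star (u ω) ⬝ᵥ (A *ᵥ v ω) ∂P = (A * C).trace := by
  have h' := h.mulVec A
  have e : ∀ ω, star (u ω) ⬝ᵥ (A *ᵥ v ω) = ∑ i, (A *ᵥ v ω) i * star (u ω i) := by
    intro ω; simp [dotProduct, mul_comm]
  simp_rw [e]
  refine ⟨integrable_finsetSum _ fun i _ => (h' i i).1, ?_⟩
  rw [integral_finsetSum _ fun i _ => (h' i i).1]
  simp_rw [(h' _ _).2]
  rfl

lemma integrable_re_sesquilinear (h : HasCrossCorrelation P v u C)
    (A : Matrix (Fin m) (Fin n) ℂ) :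
    Integrable (fun ω => (star (u ω) ⬝ᵥ (A *ᵥ v ω)).re) P ∧
      ∫ ω, (star (u ω) ⬝ᵥ (A *ᵥ v ω)).re ∂P = (A * C).trace.re := by
  obtain ⟨h1, h2⟩ := h.integrable_sesquilinear A
  refine ⟨h1.re, ?_⟩
  rw [← h2]
  exact integral_re h1

lemma of_map {Ω' : Type*} [MeasurableSpace Ω'] {T : Ω' → Ω} {Q : Measure Ω'} (hT : Measurable T)
    (hv : Measurable v) (hu : Measurable u)
    (h : HasCrossCorrelation Q (fun q => v (T q)) (fun q => u (T q)) C) :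
    HasCrossCorrelation (Q.map T) v u C := by
  intro j i
  have hm : Measurable fun ω => v ω j * star (u ω i) :=
    ((measurable_pi_apply j).comp hv).mul
      (continuous_star.measurable.comp ((measurable_pi_apply i).comp hu))
  rw [integrable_map_measure hm.aestronglyMeasurable hT.aemeasurable,
    integral_map hT.aemeasurable hm.aestronglyMeasurable]
  exact h j i

end HasCrossCorrelation

section Channel

variable {M N : ℕ} (H : Matrix (Fin M) (Fin N) ℂ) {Es N0 : ℝ}

lemma hasCrossCorrelation_complexGaussian (n : ℕ) {v : ℝ} (hv : 0 < v) :
    HasCrossCorrelation (complexGaussian n v) (fun x => x) (fun x => x) ((v : ℂ) • 1) := by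
  intro i j
  refine ⟨(memLp_complexGaussian hv i).integrable_mul (memLp_complexGaussian hv j).star, ?_⟩
  rw [integral_mul_star_complexGaussian hv, Matrix.smul_apply, one_apply]
  simp

lemma isProbabilityMeasure_channelLaw (hEs : 0 < Es) (hN0 : 0 < N0) :
    IsProbabilityMeasure (channelLaw H Es N0) := by
  have := isProbabilityMeasure_complexGaussian N hEs
  have := isProbabilityMeasure_complexGaussian M hN0
  refine Measure.isProbabilityMeasure_map (Measurable.aemeasurable ?_)
  exact (Continuous.measurable (by fun_prop))

/-- The second-order statistics of the channel: `E[x xᴴ]`, `E[x yᴴ]` and `E[y yᴴ]`. -/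
lemma hasCrossCorrelation_channelLaw (hEs : 0 < Es) (hN0 : 0 < N0) :
    HasCrossCorrelation (channelLaw H Es N0) (fun q => q.2) (fun q => q.2) ((Es : ℂ) • 1) ∧
    HasCrossCorrelation (channelLaw H Es N0) (fun q => q.2) (fun q => q.1) ((Es : ℂ) • Hᴴ) ∧
    HasCrossCorrelation (channelLaw H Es N0) (fun q => q.1) (fun q => q.1)
      ((Es : ℂ) • (H * Hᴴ) + (N0 : ℂ) • 1) := by
  have := isProbabilityMeasure_complexGaussian N hEs
  have := isProbabilityMeasure_complexGaussian M hN0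
  set Q := (complexGaussian N Es).prod (complexGaussian M N0) with hQ
  have hT : Measurable fun q : (Fin N → ℂ) × (Fin M → ℂ) => (H *ᵥ q.1 + q.2, q.1) :=
    Continuous.measurable (by fun_prop)
  have hxx : HasCrossCorrelation Q (fun q => q.1) (fun q => q.1) ((Es : ℂ) • 1) := by
    have h := hasCrossCorrelation_complexGaussian N hEs
    rw [← Measure.fst_prod (μ := complexGaussian N Es) (ν := complexGaussian M N0)] at h
    intro i j
    have hm : Measurable fun x : Fin N → ℂ => x i * star (x j) :=
      Continuous.measurable (by fun_prop)
    have := h i j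
    rwa [Measure.fst, integrable_map_measure hm.aestronglyMeasurable measurable_fst.aemeasurable,
      integral_map measurable_fst.aemeasurable hm.aestronglyMeasurable] at this
  have hzz : HasCrossCorrelation Q (fun q => q.2) (fun q => q.2) ((N0 : ℂ) • 1) := by
    have h := hasCrossCorrelation_complexGaussian M hN0
    rw [← Measure.snd_prod (μ := complexGaussian N Es) (ν := complexGaussian M N0)] at h
    intro i j
    have hm : Measurable fun x : Fin M → ℂ => x i * star (x j) :=
      Continuous.measurable (by fun_prop)
    have := h i j
    rwa [Measure.snd, integrable_map_measure hm.aestronglyMeasurable measurable_snd.aemeasurable,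
      integral_map measurable_snd.aemeasurable hm.aestronglyMeasurable] at this
  have hxz : HasCrossCorrelation Q (fun q => q.1) (fun q => q.2) 0 := by
    intro i j
    refine ⟨((memLp_complexGaussian hEs i).integrable (by norm_num)).mul_prod
      ((memLp_complexGaussian hN0 j).star.integrable (by norm_num)), ?_⟩
    rw [hQ, integral_prod_mul (fun x : Fin N → ℂ => x i) (fun z : Fin M → ℂ => star (z j)),
      integral_eval_complexGaussian hEs]
    simp
  have hyx : HasCrossCorrelation Q (fun q => H *ᵥ q.1 + q.2) (fun q => q.1) ((Es : ℂ) • H) := by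
    simpa using (hxx.mulVec H).add hxz.symm
  have hyz : HasCrossCorrelation Q (fun q => H *ᵥ q.1 + q.2) (fun q => q.2) ((N0 : ℂ) • 1) := by
    simpa using (hxz.mulVec H).add hzz
  have hxy : HasCrossCorrelation Q (fun q => q.1) (fun q => H *ᵥ q.1 + q.2) ((Es : ℂ) • Hᴴ) := by
    simpa using hyx.symm
  have hyy : HasCrossCorrelation Q (fun q => H *ᵥ q.1 + q.2) (fun q => H *ᵥ q.1 + q.2)
      ((Es : ℂ) • (H * Hᴴ) + (N0 : ℂ) • 1) := by
    simpa using (hxy.mulVec H).add hyz.symm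
  exact ⟨.of_map hT measurable_snd measurable_snd hxx, .of_map hT measurable_snd measurable_fst hxy,
    .of_map hT measurable_fst measurable_fst hyy⟩

end Channel

lemma extExpectation_coe {Ω : Type*} [MeasurableSpace Ω] {P : Measure Ω} {f : Ω → ℝ}
    (hf : Integrable f P) :
    extExpectation P (fun ω => (f ω : EReal)) = ((∫ ω, f ω ∂P : ℝ) : EReal) := by
  have h1 : ∫⁻ ω, ENNReal.ofReal (f ω) ∂P ≠ ⊤ := hf.lintegral_lt_top.ne
  have h2 : ∫⁻ ω, ENNReal.ofReal (-f ω) ∂P ≠ ⊤ := hf.neg.lintegral_lt_top.ne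
  have e : ∀ ω, (-(f ω : EReal)).toENNReal = ENNReal.ofReal (-f ω) := by
    intro ω; rw [← EReal.coe_neg, EReal.toENNReal_of_ne_top (EReal.coe_ne_top _), EReal.toReal_coe]
  have e' : ∀ ω, ((f ω : EReal)).toENNReal = ENNReal.ofReal (f ω) := by
    intro ω; rw [EReal.toENNReal_of_ne_top (EReal.coe_ne_top _), EReal.toReal_coe]
  rw [integral_eq_lintegral_pos_part_sub_lintegral_neg_part hf, extExpectation]
  simp_rw [e, e']
  rw [EReal.coe_sub, EReal.coe_ennreal_toReal h1, EReal.coe_ennreal_toReal h2]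

lemma extExpectation_top {Ω : Type*} [MeasurableSpace Ω] (P : Measure Ω) [IsProbabilityMeasure P] :
    extExpectation P (fun _ => ⊤) = ⊤ := by
  simp [extExpectation]

section Rate

variable {M N : ℕ}

/-- The prior term `xᴴ x / Es` of the metric cancels the exponent of the prior density, leaving a
Gaussian integral with respect to Lebesgue measure. -/
lemma outputWeight_modifiedMetric {Es : ℝ} (hEs : 0 < Es) (F : Matrix (Fin M) (Fin N) ℂ)
    (G : Matrix (Fin N) (Fin N) ℂ) (y : Fin M → ℂ) :
    outputWeight Es (modifiedMetric Es F G) y = ENNReal.ofReal ((Real.pi * Es) ^ N)⁻¹ *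
      ∫⁻ x, ENNReal.ofReal
        (Real.exp (2 * (star (Fᴴ *ᵥ y) ⬝ᵥ x).re - (star x ⬝ᵥ (G *ᵥ x)).re)) := by
  have hc : Continuous fun x : Fin N → ℂ => (star x ⬝ᵥ (G *ᵥ x)).re := by
    unfold dotProduct mulVec dotProduct; simp; fun_prop
  have hc2 : Continuous fun x : Fin N → ℂ => (star x ⬝ᵥ x).re := by
    simp_rw [star_dotProduct_self_re]; fun_prop
  have hc1 : ∀ w : Fin N → ℂ, Continuous fun x : Fin N → ℂ => (w ⬝ᵥ x).re := by
    intro w; unfold dotProduct; simp; fun_prop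
  have hc3 : Continuous fun x : Fin N → ℂ => (star y ⬝ᵥ (F *ᵥ x)).re := by
    simp_rw [dotProduct_mulVec]; exact hc1 _
  have hcm : Continuous (modifiedMetric Es F G y) := by
    unfold modifiedMetric; fun_prop
  rw [outputWeight, complexGaussian, lintegral_withDensity_eq_lintegral_mul _ (by fun_prop)
    (by fun_prop), ← lintegral_const_mul _ (by have := hc1 (star (Fᴴ *ᵥ y)); fun_prop)]
  refine lintegral_congr fun x => ?_
  rw [Pi.mul_apply, ← ENNReal.ofReal_mul (by positivity), ← ENNReal.ofReal_mul (by positivity),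
    mul_assoc, ← Real.exp_add, modifiedMetric, star_dotProduct_self_re, star_mulVec,
    conjTranspose_conjTranspose, ← dotProduct_mulVec]
  congr 3
  field_simp
  ring

lemma airLowerBound_modifiedMetric_of_singular (H : Matrix (Fin M) (Fin N) ℂ) {Es N0 : ℝ}
    (hEs : 0 < Es) (hN0 : 0 < N0) (F : Matrix (Fin M) (Fin N) ℂ) {G : Matrix (Fin N) (Fin N) ℂ}
    (hG : G.PosSemidef) (hdet : G.det = 0) :
    airLowerBound H Es N0 (modifiedMetric Es F G) = ⊥ := by
  have := isProbabilityMeasure_channelLaw H hEs hN0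
  have hw : ∀ y, outputWeight Es (modifiedMetric Es F G) y = ⊤ := by
    intro y
    rw [outputWeight_modifiedMetric hEs, lintegral_exp_quadratic_of_singular hG hdet,
      ENNReal.mul_top]
    simp only [ne_eq, ENNReal.ofReal_eq_zero, not_le]
    positivity
  simp_rw [airLowerBound, hw, ENNReal.log_top]
  rw [extExpectation_top, EReal.sub_top]

/-- The value of the rate lower bound of the metric `2 Re (yᴴ F x) - xᴴ G x + xᴴ x / Es` for
positive definite `G`. -/
noncomputable def gaussianRate (H : Matrix (Fin M) (Fin N) ℂ) (Es N0 : ℝ)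
    (F : Matrix (Fin M) (Fin N) ℂ) (G : Matrix (Fin N) (Fin N) ℂ) : ℝ :=
  N + N * Real.log Es + Real.log G.det.re + 2 * Es * (F * Hᴴ).trace.re - Es * G.trace.re
    - (F * G⁻¹ * Fᴴ * ((Es : ℂ) • (H * Hᴴ) + (N0 : ℂ) • 1)).trace.re

/-- The expectations are finite, so the extended real expression is an honest real number. -/
lemma airLowerBound_modifiedMetric (H : Matrix (Fin M) (Fin N) ℂ) {Es N0 : ℝ}
    (hEs : 0 < Es) (hN0 : 0 < N0) (F : Matrix (Fin M) (Fin N) ℂ) {G : Matrix (Fin N) (Fin N) ℂ}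
    (hG : G.PosDef) :
    airLowerBound H Es N0 (modifiedMetric Es F G) = (gaussianRate H Es N0 F G : EReal) := by
  have := isProbabilityMeasure_channelLaw H hEs hN0
  obtain ⟨hxx, hxy, hyy⟩ := hasCrossCorrelation_channelLaw H hEs hN0
  have hdet : 0 < G.det.re := (Complex.lt_def.mp hG.det_pos).1
  have hw : ∀ y, ENNReal.log (outputWeight Es (modifiedMetric Es F G) y)
      = (((star y ⬝ᵥ ((F * G⁻¹ * Fᴴ) *ᵥ y)).re - Real.log G.det.re - N * Real.log Es : ℝ)
        : EReal) := by
    intro y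
    rw [outputWeight_modifiedMetric hEs, lintegral_exp_quadratic hG,
      ← ENNReal.ofReal_mul (by positivity), ENNReal.log_ofReal_of_pos (by positivity),
      Real.log_mul (by positivity) (by positivity), Real.log_mul (by positivity) (by positivity),
      Real.log_mul (by positivity) (by positivity), Real.log_inv, Real.log_inv, Real.log_exp,
      mul_pow, Real.log_mul (by positivity) (by positivity), Real.log_pow, Real.log_pow,
      star_mulVec, conjTranspose_conjTranspose, ← dotProduct_mulVec, mulVec_mulVec, mulVec_mulVec]
    congr 1
    ring
  obtain ⟨i1, e1⟩ := hxy.integrable_re_sesquilinear F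
  obtain ⟨i2, e2⟩ := hxx.integrable_re_sesquilinear G
  obtain ⟨i3, e3⟩ := hxx.integrable_re_sesquilinear 1
  obtain ⟨i4, e4⟩ := hyy.integrable_re_sesquilinear (F * G⁻¹ * Fᴴ)
  simp_rw [one_mulVec] at i3 e3
  have hm : ∀ f : (Fin M → ℂ) → ℝ, Measurable f → Integrable (fun q => f q.1) (channelLaw H Es N0) →
      extExpectation (channelLaw H Es N0).fst (fun y => (f y : EReal))
        = ((∫ q, f q.1 ∂channelLaw H Es N0 : ℝ) : EReal) := by
    intro f hf hi
    rw [extExpectation_coe, Measure.fst, integral_map measurable_fst.aemeasurable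
      hf.aestronglyMeasurable]
    rwa [Measure.fst, integrable_map_measure hf.aestronglyMeasurable measurable_fst.aemeasurable]
  have hc : Continuous fun y : Fin M → ℂ => (star y ⬝ᵥ ((F * G⁻¹ * Fᴴ) *ᵥ y)).re := by
    unfold dotProduct mulVec dotProduct; simp; fun_prop
  simp_rw [airLowerBound, hw, Real.log_exp]
  have j4 : Integrable (fun q : (Fin M → ℂ) × (Fin N → ℂ) =>
      (star q.1 ⬝ᵥ ((F * G⁻¹ * Fᴴ) *ᵥ q.1)).re - Real.log G.det.re) (channelLaw H Es N0) :=
    i4.sub (integrable_const _)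
  have j1 : Integrable (fun q : (Fin M → ℂ) × (Fin N → ℂ) =>
      2 * (star q.1 ⬝ᵥ (F *ᵥ q.2)).re - (star q.2 ⬝ᵥ (G *ᵥ q.2)).re) (channelLaw H Es N0) :=
    (i1.const_mul 2).sub i2
  have j5 : Integrable (fun q : (Fin M → ℂ) × (Fin N → ℂ) =>
      2 * (star q.1 ⬝ᵥ (F *ᵥ q.2)).re - (star q.2 ⬝ᵥ (G *ᵥ q.2)).re
        + 1 / Es * (star q.2 ⬝ᵥ q.2).re) (channelLaw H Es N0) :=
    j1.add (i3.const_mul _)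
  rw [hm _ (by fun_prop) (j4.sub (integrable_const _)),
    integral_sub j4 (integrable_const _), integral_sub i4 (integrable_const _)]
  simp only [modifiedMetric]
  rw [extExpectation_coe j5, integral_add j1 (i3.const_mul _),
    integral_sub (i1.const_mul 2) i2, integral_const_mul, integral_const_mul, e1, e2, e3, e4,
    ← EReal.coe_sub]
  congr 1
  simp [gaussianRate]
  field_simp
  ring

end Rate

/-! ### Triangular matrices and the block structure of the punctured matrix -/

section Triangular

variable {n : ℕ} {L : Matrix (Fin n) (Fin n) ℂ}

lemma IsLowerTriangular.det_eq (hL : IsLowerTriangular L) : L.det = ∏ i, L i i :=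
  det_of_isLowerTriangular L fun i j h => hL i j h

lemma HasPosDiag.ne_zero (hL : HasPosDiag L) (i : Fin n) : L i i ≠ 0 := fun h => by
  have := (hL i).1
  simp [h] at this

lemma IsLowerTriangular.isUnit_det (hL : IsLowerTriangular L) (hd : HasPosDiag L) :
    IsUnit L.det := by
  rw [hL.det_eq, isUnit_iff_ne_zero, Finset.prod_ne_zero_iff]
  exact fun i _ => hd.ne_zero i

lemma IsLowerTriangular.inv (hL : IsLowerTriangular L) (hd : IsUnit L.det) :
    IsLowerTriangular L⁻¹ := by
  have := L.invertibleOfIsUnitDet hd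
  have h : BlockTriangular L OrderDual.toDual := fun i j h => hL i j h
  exact fun i j hij => blockTriangular_inv_of_blockTriangular h hij

/-- Strictly lower triangular times lower triangular has zero diagonal. -/
lemma mul_diag_eq_zero {D T : Matrix (Fin n) (Fin n) ℂ} (hD : IsLowerTriangular D)
    (hD0 : ∀ i, D i i = 0) (hT : IsLowerTriangular T) (i : Fin n) : (D * T) i i = 0 := by
  rw [mul_apply]
  refine Finset.sum_eq_zero fun j _ => ?_
  rcases lt_trichotomy j i with h | h | h
  · rw [hT j i h, mul_zero]
  · rw [h, hD0, zero_mul]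
  · rw [hD i j h, zero_mul]

end Triangular

section Blocks

variable {ν k : ℕ} {L : Matrix (Fin (ν + k)) (Fin (ν + k)) ℂ}

/-- The upper left `ν × ν` block. -/
def parentBlock (L : Matrix (Fin (ν + k)) (Fin (ν + k)) ℂ) : Matrix (Fin ν) (Fin ν) ℂ :=
  L.submatrix (Fin.castAdd k) (Fin.castAdd k)

/-- The lower left `k × ν` block. -/
def lowerLeftBlock (L : Matrix (Fin (ν + k)) (Fin (ν + k)) ℂ) : Matrix (Fin k) (Fin ν) ℂ :=
  L.submatrix (Fin.natAdd ν) (Fin.castAdd k)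

lemma IsLowerTriangular.submatrix_eq (hL : IsLowerTriangular L) :
    L.submatrix finSumFinEquiv finSumFinEquiv
      = fromBlocks (parentBlock L) 0 (lowerLeftBlock L) (childBlock L) := by
  ext i j
  rcases i with i | i <;> rcases j with j | j
  · simp [parentBlock]
  · simp only [submatrix_apply, finSumFinEquiv_apply_left, finSumFinEquiv_apply_right,
      fromBlocks_apply₁₂, Matrix.zero_apply]
    exact hL _ _ (by rw [Fin.lt_def]; simp; omega)
  · simp [lowerLeftBlock]
  · simp [childBlock]

lemma IsLowerTriangular.parentBlock (hL : IsLowerTriangular L) :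
    IsLowerTriangular (parentBlock L) := fun _ _ h => hL _ _ (by rw [Fin.lt_def] at h ⊢; simpa using h)

lemma IsLowerTriangular.childBlock (hL : IsLowerTriangular L) :
    IsLowerTriangular (childBlock L) := fun _ _ h => hL _ _ (by rw [Fin.lt_def] at h ⊢; simpa using h)

lemma isUnit_det_childBlock (hL : IsLowerTriangular L) (hd : HasPosDiag L) :
    IsUnit (childBlock L).det :=
  hL.childBlock.isUnit_det fun _ => hd _

lemma inv_mul_conjTranspose_diag_pos {S : Matrix (Fin k) (Fin k) ℂ} (hS : IsUnit S.det)
    (i : Fin k) : 0 < (S⁻¹ * (S⁻¹)ᴴ) i i := by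
  have h : (S⁻¹ * (S⁻¹)ᴴ).PosDef := by
    refine (posSemidef_self_mul_conjTranspose _).posDef_iff_isUnit.mpr ?_
    have hu : IsUnit S⁻¹ := (isUnit_nonsing_inv_iff).mpr ((isUnit_iff_isUnit_det _).mpr hS)
    exact hu.mul hu.star
  exact h.diag_pos

/-- The rows of the puncturing matrix are unit vectors. -/
lemma puncturingMatrix_mul_conjTranspose_diag (hS : IsUnit (childBlock L).det)
    (i : Fin (ν + k)) : (puncturingMatrix L * (puncturingMatrix L)ᴴ) i i = 1 := by
  obtain ⟨i, rfl⟩ := finSumFinEquiv.surjective i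
  have e : ((puncturingMatrix L * (puncturingMatrix L)ᴴ).submatrix finSumFinEquiv finSumFinEquiv)
      = fromBlocks (1 : Matrix (Fin ν) (Fin ν) ℂ) 0 0
        (rowNormalizer (childBlock L) * ((childBlock L)⁻¹ * ((childBlock L)⁻¹)ᴴ)
          * (rowNormalizer (childBlock L))ᴴ) := by
    rw [← submatrix_mul_equiv _ _ _ finSumFinEquiv, ← conjTranspose_submatrix]
    simp [puncturingMatrix, fromBlocks_conjTranspose, fromBlocks_multiply, Matrix.mul_assoc]
  refine (congrFun (congrFun e i) i).trans ?_
  rcases i with i | i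
  · simp
  · have hp := inv_mul_conjTranspose_diag_pos hS i
    obtain ⟨h1, h2⟩ := Complex.lt_def.mp hp
    set z := ((childBlock L)⁻¹ * ((childBlock L)⁻¹)ᴴ) i i with hz
    have hzr : z = (z.re : ℂ) := by
      apply Complex.ext <;> simp [← h2]
    rw [fromBlocks_apply₂₂, rowNormalizer, diagonal_conjTranspose, mul_diagonal, diagonal_mul,
      ← hz]
    simp only [Pi.star_apply, Complex.star_def, Complex.conj_ofReal, ← hz]
    rw [hzr, Complex.ofReal_re]
    norm_cast
    rw [mul_comm, ← mul_assoc, ← mul_inv, Real.mul_self_sqrt h1.le, inv_mul_cancel₀ h1.ne']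

lemma puncturedMatrix_submatrix (hL : IsLowerTriangular L) (hd : HasPosDiag L) :
    (puncturedMatrix L).submatrix finSumFinEquiv finSumFinEquiv
      = fromBlocks (parentBlock L) 0
        (rowNormalizer (childBlock L) * (childBlock L)⁻¹ * lowerLeftBlock L)
        (rowNormalizer (childBlock L)) := by
  rw [puncturedMatrix, ← submatrix_mul_equiv _ _ _ finSumFinEquiv, hL.submatrix_eq]
  simp [puncturingMatrix, fromBlocks_multiply, Matrix.mul_assoc,
    nonsing_inv_mul _ (isUnit_det_childBlock hL hd)]

lemma isPunctured_puncturedMatrix (hL : IsLowerTriangular L) (hd : HasPosDiag L) :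
    IsPunctured ν (puncturedMatrix L) := by
  have e := fun i j => congrFun (congrFun (puncturedMatrix_submatrix hL hd) i) j
  simp only [submatrix_apply] at e
  constructor
  · intro i j hij
    obtain ⟨i, rfl⟩ := finSumFinEquiv.surjective i
    obtain ⟨j, rfl⟩ := finSumFinEquiv.surjective j
    rw [e]
    rcases i with i | i <;> rcases j with j | j
    · exact hL.parentBlock _ _ (by rw [Fin.lt_def] at hij ⊢; simpa using hij)
    · rfl
    · rw [Fin.lt_def] at hij; simp at hij; omega
    · rw [Fin.lt_def] at hij; simp at hij
      rw [fromBlocks_apply₂₂, rowNormalizer]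
      exact diagonal_apply_ne _ hij.ne
  · intro i j hj hij
    obtain ⟨i, rfl⟩ := finSumFinEquiv.surjective i
    obtain ⟨j, rfl⟩ := finSumFinEquiv.surjective j
    rw [e]
    rcases i with i | i <;> rcases j with j | j
    · simp at hj; omega
    · rfl
    · simp at hj; omega
    · rw [Fin.lt_def] at hij; simp at hij
      rw [fromBlocks_apply₂₂, rowNormalizer]
      exact diagonal_apply_ne _ hij.ne'

lemma hasPosDiag_puncturedMatrix (hL : IsLowerTriangular L) (hd : HasPosDiag L) :
    HasPosDiag (puncturedMatrix L) := by
  intro i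
  obtain ⟨i, rfl⟩ := finSumFinEquiv.surjective i
  have e := congrFun (congrFun (puncturedMatrix_submatrix hL hd) i) i
  simp only [submatrix_apply] at e
  rw [e]
  rcases i with i | i
  · exact hd _
  · have h := (Complex.lt_def.mp
      (inv_mul_conjTranspose_diag_pos (isUnit_det_childBlock hL hd) i)).1
    rw [fromBlocks_apply₂₂, rowNormalizer, diagonal_apply_eq]
    refine ⟨?_, Complex.ofReal_im _⟩
    rw [Complex.ofReal_re]
    exact inv_pos.mpr (Real.sqrt_pos.mpr h)

/-- Each row of the puncturing matrix `V` is orthogonal to the corresponding row of `D L⁻¹`, for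
every punctured `D` with zero diagonal: the first `ν` rows of `D L⁻¹` are strictly lower triangular,
and its last `k` rows are supported on the first `ν` columns. -/
lemma mul_inv_mul_puncturingMatrix_diag (hL : IsLowerTriangular L) (hd : HasPosDiag L)
    {D : Matrix (Fin (ν + k)) (Fin (ν + k)) ℂ} (hD : IsPunctured ν D) (hD0 : ∀ i, D i i = 0)
    (i : Fin (ν + k)) : (D * L⁻¹ * (puncturingMatrix L)ᴴ) i i = 0 := by
  obtain ⟨i, rfl⟩ := finSumFinEquiv.surjective i
  have hLu := hL.isUnit_det hd
  have hLi := hL.inv hLu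
  have hDS : childBlock D = 0 := by
    ext a b
    rcases lt_trichotomy a b with h | h | h
    · exact hD.1.childBlock _ _ h
    · subst h; exact hD0 _
    · exact hD.2 _ _ (by simp) (by rw [Fin.lt_def] at h ⊢; simpa using h)
  have e : (D * L⁻¹ * (puncturingMatrix L)ᴴ).submatrix finSumFinEquiv finSumFinEquiv
      = fromBlocks (parentBlock D * parentBlock L⁻¹) 0 (lowerLeftBlock D * parentBlock L⁻¹) 0 := by
    rw [← submatrix_mul_equiv _ _ _ finSumFinEquiv, ← submatrix_mul_equiv _ _ _ finSumFinEquiv,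
      ← conjTranspose_submatrix, hD.1.submatrix_eq, hLi.submatrix_eq, hDS]
    simp [puncturingMatrix, fromBlocks_conjTranspose, fromBlocks_multiply]
  refine (congrFun (congrFun e i) i).trans ?_
  rcases i with i | i
  · exact mul_diag_eq_zero hD.1.parentBlock (fun _ => hD0 _) hLi.parentBlock i
  · rfl

end Blocks

/-! ### Optimization over `F`: the MMSE filter -/

section Filter

variable {M N : ℕ}

lemma trace_mul_conjTranspose_self_re {m n : ℕ} (X : Matrix (Fin m) (Fin n) ℂ) :
    0 ≤ (X * Xᴴ).trace.re ∧ ((X * Xᴴ).trace.re = 0 → X = 0) := by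
  have h := (posSemidef_self_mul_conjTranspose X).trace_nonneg
  obtain ⟨h1, h2⟩ := Complex.le_def.mp h
  refine ⟨h1, fun h0 => trace_mul_conjTranspose_self_eq_zero_iff.mp ?_⟩
  exact Complex.ext h0 h2.symm

/-- The squared norm of `X`, weighted by positive definite matrices on both sides. -/
lemma trace_weighted_re {m n : ℕ} {R : Matrix (Fin m) (Fin m) ℂ} {K : Matrix (Fin n) (Fin n) ℂ}
    (hR : R.PosDef) (hK : K.PosDef) (X : Matrix (Fin m) (Fin n) ℂ) :
    0 ≤ (X * K * Xᴴ * R).trace.re ∧ ((X * K * Xᴴ * R).trace.re = 0 → X = 0) := by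
  obtain ⟨A, hA, rfl⟩ := exists_eq_conjTranspose_mul_self hR
  obtain ⟨C, hC, rfl⟩ := exists_eq_conjTranspose_mul_self hK
  have e : (X * (Cᴴ * C) * Xᴴ * (Aᴴ * A)).trace = ((A * X * Cᴴ) * (A * X * Cᴴ)ᴴ).trace := by
    rw [← Matrix.mul_assoc _ Aᴴ A, trace_mul_comm]
    simp only [conjTranspose_mul, conjTranspose_conjTranspose, Matrix.mul_assoc]
  rw [e]
  refine ⟨(trace_mul_conjTranspose_self_re _).1, fun h => ?_⟩
  have h0 := (trace_mul_conjTranspose_self_re _).2 h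
  have hCu : IsUnit Cᴴ.det := by
    rw [det_conjTranspose]; exact (isUnit_iff_ne_zero.mpr hC).star
  have hAu : IsUnit A.det := isUnit_iff_ne_zero.mpr hA
  calc X = A⁻¹ * (A * X * Cᴴ) * (Cᴴ)⁻¹ := by
        rw [Matrix.mul_assoc A X, nonsing_inv_mul_cancel_left _ _ hAu,
          mul_nonsing_inv_cancel_right _ _ hCu]
    _ = 0 := by rw [h0, Matrix.mul_zero, Matrix.zero_mul]

variable (H : Matrix (Fin M) (Fin N) ℂ) {Es N0 : ℝ}

lemma posDef_outputCovariance (hEs : 0 < Es) (hN0 : 0 < N0) :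
    ((Es : ℂ) • (H * Hᴴ) + (N0 : ℂ) • 1).PosDef :=
  PosDef.posSemidef_add ((posSemidef_self_mul_conjTranspose H).smul (by exact_mod_cast hEs.le))
    (PosDef.one.smul (by exact_mod_cast hN0))

/-- The normal equation of the MMSE filter: `W E[y yᴴ] = E[x yᴴ]`. -/
lemma mmseFilter_mul_outputCovariance (hEs : 0 < Es) (hN0 : 0 < N0) :
    mmseFilter H Es N0 * ((Es : ℂ) • (H * Hᴴ) + (N0 : ℂ) • 1) = (Es : ℂ) • Hᴴ := by
  have hE : (Es : ℂ) ≠ 0 := by exact_mod_cast hEs.ne'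
  have hpd : (H * Hᴴ + ((N0 / Es : ℝ) : ℂ) • (1 : Matrix (Fin M) (Fin M) ℂ)).PosDef :=
    PosDef.posSemidef_add (posSemidef_self_mul_conjTranspose H)
      (PosDef.one.smul (by exact_mod_cast div_pos hN0 hEs))
  have hu := (isUnit_iff_isUnit_det _).mp hpd.isUnit
  have e : (Es : ℂ) • (H * Hᴴ) + (N0 : ℂ) • (1 : Matrix (Fin M) (Fin M) ℂ)
      = (Es : ℂ) • (H * Hᴴ + ((N0 / Es : ℝ) : ℂ) • 1) := by
    rw [smul_add, smul_smul]
    congr 2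
    push_cast
    field_simp
  rw [e, mmseFilter, Matrix.mul_smul, Matrix.mul_assoc, nonsing_inv_mul _ hu, Matrix.mul_one]

/-- The MMSE error covariance `Es (I - W H)` is the inverse of the Gram matrix of the augmented
channel. -/
lemma mmse_error_eq_inv (hEs : 0 < Es) (hN0 : 0 < N0) {Q : Matrix (Fin M ⊕ Fin N) (Fin N) ℂ}
    {L : Matrix (Fin N) (Fin N) ℂ} (hQL : IsThinQL (augmentedChannel H Es N0) Q L) :
    (Lᴴ * L)⁻¹ = (Es : ℂ) • (1 - mmseFilter H Es N0 * H) := by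
  have hE : (Es : ℂ) ≠ 0 := by exact_mod_cast hEs.ne'
  have hN : (N0 : ℂ) ≠ 0 := by exact_mod_cast hN0.ne'
  have hgram : Lᴴ * L = (N0 : ℂ)⁻¹ • (Hᴴ * H) + (Es : ℂ)⁻¹ • 1 := by
    have h1 : (augmentedChannel H Es N0)ᴴ * augmentedChannel H Es N0 = Lᴴ * L := by
      rw [hQL.eq_mul, conjTranspose_mul, Matrix.mul_assoc, ← Matrix.mul_assoc Qᴴ,
        hQL.orthonormal, Matrix.one_mul]
    have hs : ∀ a : ℝ, 0 < a → (Real.sqrt a : ℂ)⁻¹ * (Real.sqrt a : ℂ)⁻¹ = (a : ℂ)⁻¹ := by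
      intro a ha
      rw [← mul_inv, ← Complex.ofReal_mul, Real.mul_self_sqrt ha.le]
    rw [← h1, augmentedChannel, conjTranspose_fromRows_eq_fromCols_conjTranspose,
      fromCols_mul_fromRows]
    simp [smul_smul, hs _ hEs, hs _ hN0]
  set W := mmseFilter H Es N0 with hW
  -- `hpush` is the push-through identity; it follows from the normal equation by cancelling the
  -- output covariance on the right.
  have hn := mmseFilter_mul_outputCovariance H hEs hN0
  have hR : IsUnit ((Es : ℂ) • (H * Hᴴ) + (N0 : ℂ) • (1 : Matrix (Fin M) (Fin M) ℂ)).det :=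
    (isUnit_iff_isUnit_det _).mp (posDef_outputCovariance H hEs hN0).isUnit
  have hpush : ((Es : ℂ) • (Hᴴ * H) + (N0 : ℂ) • 1) * W = (Es : ℂ) • Hᴴ := by
    have h2 : ((Es : ℂ) • (Hᴴ * H) + (N0 : ℂ) • 1) * W
        * ((Es : ℂ) • (H * Hᴴ) + (N0 : ℂ) • 1)
        = (Es : ℂ) • Hᴴ * ((Es : ℂ) • (H * Hᴴ) + (N0 : ℂ) • 1) := by
      rw [Matrix.mul_assoc, hn]
      simp only [Matrix.add_mul, Matrix.mul_add, Matrix.smul_mul, Matrix.mul_smul, Matrix.one_mul,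
        Matrix.mul_one, Matrix.mul_assoc]
      rw [smul_add, smul_comm (N0 : ℂ)]
    have h3 := congrArg (· * ((Es : ℂ) • (H * Hᴴ) + (N0 : ℂ) • (1 : Matrix (Fin M) (Fin M) ℂ))⁻¹) h2
    simpa only [mul_nonsing_inv_cancel_right _ _ hR] using h3
  refine inv_eq_right_inv ?_
  have h4 : (N0 : ℂ)⁻¹ • (Hᴴ * H) + (Es : ℂ)⁻¹ • (1 : Matrix (Fin N) (Fin N) ℂ)
      = ((N0 : ℂ)⁻¹ * (Es : ℂ)⁻¹) • ((Es : ℂ) • (Hᴴ * H) + (N0 : ℂ) • 1) := by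
    rw [smul_add, smul_smul, smul_smul]
    congr 2 <;> field_simp
  rw [hgram, h4, Matrix.smul_mul, Matrix.mul_smul, Matrix.mul_sub, ← Matrix.mul_assoc, hpush,
    Matrix.mul_one, Matrix.smul_mul, add_sub_cancel_left, smul_smul, smul_smul]
  rw [show (N0 : ℂ)⁻¹ * (Es : ℂ)⁻¹ * Es * N0 = 1 by field_simp, one_smul]

/-- Completing the square in `F`: the rate is a function of `G` alone minus a weighted squared
distance from `F` to `Wᴴ G`, `W` being the MMSE filter. -/
lemma gaussianRate_eq (hEs : 0 < Es) (hN0 : 0 < N0) {Q : Matrix (Fin M ⊕ Fin N) (Fin N) ℂ}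
    {L : Matrix (Fin N) (Fin N) ℂ} (hQL : IsThinQL (augmentedChannel H Es N0) Q L)
    (F : Matrix (Fin M) (Fin N) ℂ) {G : Matrix (Fin N) (Fin N) ℂ} (hG : G.PosDef) :
    gaussianRate H Es N0 F G = N + N * Real.log Es + Real.log G.det.re
      - (G * (Lᴴ * L)⁻¹).trace.re
      - ((F - (mmseFilter H Es N0)ᴴ * G) * G⁻¹ * (F - (mmseFilter H Es N0)ᴴ * G)ᴴ
        * ((Es : ℂ) • (H * Hᴴ) + (N0 : ℂ) • 1)).trace.re := by
  have hn := mmseFilter_mul_outputCovariance H hEs hN0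
  have hRh := (posDef_outputCovariance H hEs hN0).isHermitian.eq
  rw [mmse_error_eq_inv H hEs hN0 hQL, gaussianRate]
  set W := mmseFilter H Es N0 with hW
  set R := (Es : ℂ) • (H * Hᴴ) + (N0 : ℂ) • (1 : Matrix (Fin M) (Fin M) ℂ) with hR
  set E := F - Wᴴ * G with hE
  have hF : F = E + Wᴴ * G := by rw [hE]; abel
  have hu : IsUnit G.det := (isUnit_iff_isUnit_det _).mp hG.isUnit
  have hGh : Gᴴ = G := hG.isHermitian.eq
  have hn' : R * Wᴴ = (Es : ℂ) • H := by
    have := congrArg conjTranspose hn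
    rw [conjTranspose_mul, hRh] at this
    simpa using this
  have hre : ∀ {n : ℕ} (X : Matrix (Fin n) (Fin n) ℂ), Xᴴ.trace.re = X.trace.re := by
    intro n X; rw [trace_conjTranspose]; simp
  clear_value R
  have t1 : F * G⁻¹ * Fᴴ * R = E * G⁻¹ * Eᴴ * R + (Es : ℂ) • (E * Hᴴ) + Wᴴ * Eᴴ * R
      + (Es : ℂ) • (Wᴴ * G * Hᴴ) := by
    rw [hF, conjTranspose_add, conjTranspose_mul, conjTranspose_conjTranspose, hGh]
    have a : (E + Wᴴ * G) * G⁻¹ = E * G⁻¹ + Wᴴ := by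
      rw [Matrix.add_mul, mul_nonsing_inv_cancel_right _ _ hu]
    have b : E * G⁻¹ * (G * W) * R = (Es : ℂ) • (E * Hᴴ) := by
      rw [← Matrix.mul_assoc, nonsing_inv_mul_cancel_right _ _ hu, Matrix.mul_assoc, hn,
        Matrix.mul_smul]
    have c : Wᴴ * (G * W) * R = (Es : ℂ) • (Wᴴ * G * Hᴴ) := by
      rw [Matrix.mul_assoc, Matrix.mul_assoc, hn]; simp [Matrix.mul_assoc]
    rw [a, Matrix.add_mul, Matrix.mul_add, Matrix.mul_add, Matrix.add_mul, Matrix.add_mul,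
      Matrix.add_mul, b, c]
    abel
  have t2 : (Wᴴ * Eᴴ * R).trace.re = Es * (E * Hᴴ).trace.re := by
    rw [trace_mul_comm, ← Matrix.mul_assoc, hn', ← hre (E * Hᴴ)]
    simp
  have t3 : (Wᴴ * G * Hᴴ).trace.re = (G * (W * H)).trace.re := by
    rw [← hre, conjTranspose_mul, conjTranspose_mul, hGh]
    simp only [conjTranspose_conjTranspose]
    rw [trace_mul_comm, Matrix.mul_assoc]
  have t4 : (F * Hᴴ).trace.re = (E * Hᴴ).trace.re + (Wᴴ * G * Hᴴ).trace.re := by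
    rw [hF, Matrix.add_mul, trace_add, Complex.add_re]
  rw [t1, t4]
  simp only [trace_add, trace_smul, Complex.add_re, smul_eq_mul, Complex.re_ofReal_mul, t2, t3,
    Matrix.mul_smul, Matrix.mul_sub, Matrix.mul_one, trace_sub, Complex.sub_re]
  ring

end Filter

/-! ### Optimization over punctured factors -/

section Optimization

variable {ν k : ℕ} {L : Matrix (Fin (ν + k)) (Fin (ν + k)) ℂ}

lemma trace_gram_mul_inv (J : Matrix (Fin (ν + k)) (Fin (ν + k)) ℂ) :
    (Jᴴ * J * (Lᴴ * L)⁻¹).trace = (J * L⁻¹ * (J * L⁻¹)ᴴ).trace := by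
  rw [Matrix.mul_inv_rev, ← conjTranspose_nonsing_inv, Matrix.mul_assoc, trace_mul_comm,
    conjTranspose_mul]
  simp only [Matrix.mul_assoc]

lemma det_conjTranspose_mul_self_re {n : ℕ} {J : Matrix (Fin n) (Fin n) ℂ}
    (hJ : IsLowerTriangular J) : (Jᴴ * J).det.re = ∏ i, ‖J i i‖ ^ 2 := by
  rw [det_mul, det_conjTranspose, Complex.star_def, Complex.conj_mul', ← Complex.ofReal_pow,
    Complex.ofReal_re, hJ.det_eq, norm_prod, Finset.prod_pow]

lemma puncturedMatrix_mul_inv (hL : IsUnit L.det) :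
    puncturedMatrix L * L⁻¹ = puncturingMatrix L :=
  mul_nonsing_inv_cancel_right _ _ hL

lemma trace_puncturedMatrix_gram (hL : IsLowerTriangular L) (hd : HasPosDiag L) :
    ((puncturedMatrix L)ᴴ * puncturedMatrix L * (Lᴴ * L)⁻¹).trace.re = ((ν + k : ℕ) : ℝ) := by
  rw [trace_gram_mul_inv, puncturedMatrix_mul_inv (hL.isUnit_det hd), trace]
  simp [puncturingMatrix_mul_conjTranspose_diag (isUnit_det_childBlock hL hd)]

/-- Decomposition of a punctured factor along the rows of the punctured matrix: with
`J = diag c * Lap + D`, `D` of zero diagonal, the squared norm of `J L⁻¹` is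
`∑ |cᵢ|² + ‖D L⁻¹‖²`. -/
lemma trace_gram_eq_of_isPunctured (hL : IsLowerTriangular L) (hd : HasPosDiag L)
    {D : Matrix (Fin (ν + k)) (Fin (ν + k)) ℂ} (hD : IsPunctured ν D) (hD0 : ∀ i, D i i = 0)
    (c : Fin (ν + k) → ℂ) :
    ((diagonal c * puncturedMatrix L + D)ᴴ * (diagonal c * puncturedMatrix L + D)
      * (Lᴴ * L)⁻¹).trace.re = ∑ i, ‖c i‖ ^ 2 + (D * L⁻¹ * (D * L⁻¹)ᴴ).trace.re := by
  have hV := puncturingMatrix_mul_conjTranspose_diag (isUnit_det_childBlock hL hd)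
  have hX := mul_inv_mul_puncturingMatrix_diag hL hd hD hD0
  rw [trace_gram_mul_inv, Matrix.add_mul, Matrix.mul_assoc (diagonal c),
    puncturedMatrix_mul_inv (hL.isUnit_det hd)]
  set V := puncturingMatrix L
  set X := D * L⁻¹
  have h1 : (diagonal c * V * (diagonal c * V)ᴴ).trace.re = ∑ i, ‖c i‖ ^ 2 := by
    rw [conjTranspose_mul, Matrix.mul_assoc, ← Matrix.mul_assoc V, diagonal_conjTranspose, trace,
      Complex.re_sum]
    refine Finset.sum_congr rfl fun i _ => ?_
    rw [diag_apply, diagonal_mul, mul_diagonal, hV, one_mul, Pi.star_apply, Complex.star_def,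
      Complex.mul_conj', ← Complex.ofReal_pow, Complex.ofReal_re]
  have h2 : (X * (diagonal c * V)ᴴ).trace = 0 := by
    rw [conjTranspose_mul, ← Matrix.mul_assoc, diagonal_conjTranspose, trace]
    refine Finset.sum_eq_zero fun i _ => ?_
    rw [diag_apply, mul_diagonal, hX, zero_mul]
  have h3 : (diagonal c * V * Xᴴ).trace = 0 := by
    rw [← conjTranspose_conjTranspose (diagonal c * V), ← conjTranspose_mul, trace_conjTranspose,
      h2, star_zero]
  rw [conjTranspose_add, Matrix.add_mul, Matrix.mul_add, Matrix.mul_add]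
  simp only [trace_add, h2, h3, Complex.add_re, h1]
  simp

/-- Among Gram matrices `G = Jᴴ J` of nonsingular punctured factors, `log det G - tr (G (LᴴL)⁻¹)`
has the Gram matrix of the punctured matrix as its unique maximizer. -/
lemma log_det_sub_trace_le (hL : IsLowerTriangular L) (hd : HasPosDiag L)
    {J : Matrix (Fin (ν + k)) (Fin (ν + k)) ℂ} (hJ : IsPunctured ν J) (hdet : J.det ≠ 0) :
    Real.log (Jᴴ * J).det.re - (Jᴴ * J * (Lᴴ * L)⁻¹).trace.re
      ≤ Real.log ((puncturedMatrix L)ᴴ * puncturedMatrix L).det.re - ((ν + k : ℕ) : ℝ) ∧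
    (Real.log (Jᴴ * J).det.re - (Jᴴ * J * (Lᴴ * L)⁻¹).trace.re
      = Real.log ((puncturedMatrix L)ᴴ * puncturedMatrix L).det.re - ((ν + k : ℕ) : ℝ) →
      Jᴴ * J = (puncturedMatrix L)ᴴ * puncturedMatrix L) := by
  have hP := isPunctured_puncturedMatrix hL hd
  have hPd := hasPosDiag_puncturedMatrix hL hd
  set P := puncturedMatrix L with hPdef
  -- `c` matches the diagonals of `J` and `diag c * P`, so that `D` has zero diagonal.
  set c : Fin (ν + k) → ℂ := fun i => J i i / P i i with hc
  set D := J - diagonal c * P with hDdef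
  have hJD : J = diagonal c * P + D := by rw [hDdef]; abel
  have hD : IsPunctured ν D := by
    constructor
    · intro i j hij
      rw [hDdef, Matrix.sub_apply, diagonal_mul, hJ.1 i j hij, hP.1 i j hij, mul_zero, sub_zero]
    · intro i j hj hij
      rw [hDdef, Matrix.sub_apply, diagonal_mul, hJ.2 i j hj hij, hP.2 i j hj hij, mul_zero,
        sub_zero]
  have hD0 : ∀ i, D i i = 0 := by
    intro i
    rw [hDdef, Matrix.sub_apply, diagonal_mul, hc, div_mul_cancel₀ _ (hPd.ne_zero i), sub_self]
  have hJi : ∀ i, J i i ≠ 0 := by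
    rw [hJ.1.det_eq, Finset.prod_ne_zero_iff] at hdet
    exact fun i => hdet i (Finset.mem_univ i)
  have hci : ∀ i, c i ≠ 0 := fun i => div_ne_zero (hJi i) (hPd.ne_zero i)
  have htr : (Jᴴ * J * (Lᴴ * L)⁻¹).trace.re
      = ∑ i, ‖c i‖ ^ 2 + (D * L⁻¹ * (D * L⁻¹)ᴴ).trace.re := by
    rw [← trace_gram_eq_of_isPunctured hL hd hD hD0 c, ← hPdef, ← hJD]
  have hld : Real.log (Jᴴ * J).det.re
      = ∑ i, Real.log (‖c i‖ ^ 2) + Real.log (Pᴴ * P).det.re := by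
    have hp2 : ∀ i, ‖P i i‖ ^ 2 ≠ 0 := fun i => pow_ne_zero _ (norm_ne_zero_iff.mpr (hPd.ne_zero i))
    have hc2 : ∀ i, ‖c i‖ ^ 2 ≠ 0 := fun i => pow_ne_zero _ (norm_ne_zero_iff.mpr (hci i))
    rw [det_conjTranspose_mul_self_re hJ.1, det_conjTranspose_mul_self_re hP.1,
      Real.log_prod fun i _ => hp2 i, ← Finset.sum_add_distrib, Real.log_prod fun i _ =>
        pow_ne_zero _ (norm_ne_zero_iff.mpr (hJi i))]
    refine Finset.sum_congr rfl fun i _ => ?_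
    rw [← Real.log_mul (hc2 i) (hp2 i), ← mul_pow, ← norm_mul,
      div_mul_cancel₀ _ (hPd.ne_zero i)]
  have hpos : ∀ i, 0 < ‖c i‖ ^ 2 := fun i => pow_pos (norm_pos_iff.mpr (hci i)) 2
  have hterm : ∀ i, 0 ≤ ‖c i‖ ^ 2 - Real.log (‖c i‖ ^ 2) - 1 := fun i => by
    have := Real.log_le_sub_one_of_pos (hpos i)
    linarith
  obtain ⟨hX, hX0⟩ := trace_mul_conjTranspose_self_re (D * L⁻¹)
  have hsum : ∑ i, (‖c i‖ ^ 2 - Real.log (‖c i‖ ^ 2) - 1)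
      = ∑ i, ‖c i‖ ^ 2 - ∑ i, Real.log (‖c i‖ ^ 2) - ((ν + k : ℕ) : ℝ) := by
    simp [Finset.sum_sub_distrib]
  have hsum0 := Finset.sum_nonneg fun i (_ : i ∈ Finset.univ) => hterm i
  -- The gap is `∑ (|cᵢ|² - log |cᵢ|² - 1) + ‖D L⁻¹‖²`, with all terms nonnegative.
  rw [hld, htr]
  refine ⟨by linarith, fun heq => ?_⟩
  have hs0 : ∑ i, (‖c i‖ ^ 2 - Real.log (‖c i‖ ^ 2) - 1) = 0 := by linarith
  have hDL : D * L⁻¹ = 0 := hX0 (by linarith)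
  have hDz : D = 0 := by
    rw [← nonsing_inv_mul_cancel_right L D (hL.isUnit_det hd), hDL, Matrix.zero_mul]
  have hc1 : ∀ i, ‖c i‖ ^ 2 = 1 := by
    intro i
    have h := (Finset.sum_eq_zero_iff_of_nonneg fun i _ => hterm i).mp hs0 i (Finset.mem_univ i)
    by_contra hne
    have := Real.log_lt_sub_one_of_pos (hpos i) hne
    linarith
  have hcc : (diagonal c)ᴴ * diagonal c = 1 := by
    rw [diagonal_conjTranspose, diagonal_mul_diagonal, ← diagonal_one]
    congr 1
    funext i
    rw [Pi.star_apply, Complex.star_def, Complex.conj_mul', ← Complex.ofReal_pow, hc1,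
      Complex.ofReal_one]
  rw [hJD, hDz, add_zero, conjTranspose_mul, Matrix.mul_assoc, ← Matrix.mul_assoc _ (diagonal c),
    hcc, Matrix.one_mul]

end Optimization

/-! ### The two optimality criteria -/

section Optimality

variable {M ν k : ℕ} (H : Matrix (Fin M) (Fin (ν + k)) ℂ) {Es N0 : ℝ}
  {Q : Matrix (Fin M ⊕ Fin (ν + k)) (Fin (ν + k)) ℂ} {L : Matrix (Fin (ν + k)) (Fin (ν + k)) ℂ}

lemma posDef_puncturedMatrix_gram (hL : IsLowerTriangular L) (hd : HasPosDiag L) :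
    ((puncturedMatrix L)ᴴ * puncturedMatrix L).PosDef := by
  refine (posSemidef_conjTranspose_mul_self _).posDef_iff_isUnit.mpr ?_
  have hu := (isUnit_iff_isUnit_det _).mpr
    ((isPunctured_puncturedMatrix hL hd).1.isUnit_det (hasPosDiag_puncturedMatrix hL hd))
  exact hu.star.mul hu

lemma airLowerBound_puncturedMatrix (hEs : 0 < Es) (hN0 : 0 < N0)
    (hQL : IsThinQL (augmentedChannel H Es N0) Q L) :
    airLowerBound H Es N0 (modifiedMetric Es
        ((mmseFilter H Es N0)ᴴ * ((puncturedMatrix L)ᴴ * puncturedMatrix L))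
        ((puncturedMatrix L)ᴴ * puncturedMatrix L))
      = ((((ν + k : ℕ) : ℝ) * Real.log Es
          + Real.log ((puncturedMatrix L)ᴴ * puncturedMatrix L).det.re : ℝ) : EReal) := by
  have hG := posDef_puncturedMatrix_gram hQL.lower hQL.posDiag
  rw [airLowerBound_modifiedMetric H hEs hN0 _ hG, gaussianRate_eq H hEs hN0 hQL _ hG,
    trace_puncturedMatrix_gram hQL.lower hQL.posDiag]
  congr 1
  simp only [sub_self, Matrix.zero_mul, trace_zero, Complex.zero_re]
  ring

/-- The optimality statement for one competitor: its rate is at most the claimed value, and only the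
claimed parameters reach that value. -/
lemma airLowerBound_le (hEs : 0 < Es) (hN0 : 0 < N0)
    (hQL : IsThinQL (augmentedChannel H Es N0) Q L) (F : Matrix (Fin M) (Fin (ν + k)) ℂ)
    {G : Matrix (Fin (ν + k)) (Fin (ν + k)) ℂ} (hG : HasPuncturedFactor ν G) :
    airLowerBound H Es N0 (modifiedMetric Es F G)
      ≤ ((((ν + k : ℕ) : ℝ) * Real.log Es
          + Real.log ((puncturedMatrix L)ᴴ * puncturedMatrix L).det.re : ℝ) : EReal) ∧
    (((((ν + k : ℕ) : ℝ) * Real.log Es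
          + Real.log ((puncturedMatrix L)ᴴ * puncturedMatrix L).det.re : ℝ) : EReal)
        ≤ airLowerBound H Es N0 (modifiedMetric Es F G) →
      F = (mmseFilter H Es N0)ᴴ * ((puncturedMatrix L)ᴴ * puncturedMatrix L) ∧
        G = (puncturedMatrix L)ᴴ * puncturedMatrix L) := by
  obtain ⟨hpsd, J, hJ, rfl⟩ := hG
  by_cases hdet : J.det = 0
  · have h0 : (Jᴴ * J).det = 0 := by rw [det_mul, hdet, mul_zero]
    rw [airLowerBound_modifiedMetric_of_singular H hEs hN0 F hpsd h0]
    exact ⟨bot_le, fun h => absurd (le_bot_iff.mp h) (EReal.coe_ne_bot _)⟩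
  · have hu : IsUnit J := (isUnit_iff_isUnit_det _).mpr (isUnit_iff_ne_zero.mpr hdet)
    have hG : (Jᴴ * J).PosDef := hpsd.posDef_iff_isUnit.mpr (hu.star.mul hu)
    obtain ⟨h1, h2⟩ := log_det_sub_trace_le hQL.lower hQL.posDiag hJ hdet
    obtain ⟨h3, h4⟩ := trace_weighted_re (posDef_outputCovariance H hEs hN0) hG.inv
      (F - (mmseFilter H Es N0)ᴴ * (Jᴴ * J))
    rw [airLowerBound_modifiedMetric H hEs hN0 _ hG, gaussianRate_eq H hEs hN0 hQL _ hG,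
      EReal.coe_le_coe_iff, EReal.coe_le_coe_iff]
    refine ⟨by linarith, fun h => ?_⟩
    have e1 := h2 (by linarith)
    have e2 := h4 (by linarith)
    exact ⟨by rw [← e1]; exact sub_eq_zero.mp e2, e1⟩

lemma isOptimalModified_iff (hEs : 0 < Es) (hN0 : 0 < N0)
    (hQL : IsThinQL (augmentedChannel H Es N0) Q L) (F : Matrix (Fin M) (Fin (ν + k)) ℂ)
    (G : Matrix (Fin (ν + k)) (Fin (ν + k)) ℂ) :
    IsOptimalModified ν H Es N0 F G ↔
      F = (mmseFilter H Es N0)ᴴ * ((puncturedMatrix L)ᴴ * puncturedMatrix L) ∧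
        G = (puncturedMatrix L)ᴴ * puncturedMatrix L := by
  have hval := airLowerBound_puncturedMatrix H hEs hN0 hQL
  have hfeas : HasPuncturedFactor ν ((puncturedMatrix L)ᴴ * puncturedMatrix L) :=
    ⟨posSemidef_conjTranspose_mul_self _, _,
      isPunctured_puncturedMatrix hQL.lower hQL.posDiag, rfl⟩
  constructor
  · rintro ⟨hG, hmax⟩
    refine (airLowerBound_le H hEs hN0 hQL F hG).2 ?_
    rw [← hval]
    exact hmax _ _ hfeas
  · rintro ⟨rfl, rfl⟩
    refine ⟨hfeas, fun F' G' hG' => ?_⟩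
    rw [hval]
    exact (airLowerBound_le H hEs hN0 hQL F' hG').1

/-- The prior term of the modified metric absorbs the shift of `G` by `I / Es`. -/
lemma shorteningMetric_eq_modifiedMetric {N : ℕ} (Es : ℝ) (F : Matrix (Fin M) (Fin N) ℂ)
    (G : Matrix (Fin N) (Fin N) ℂ) :
    shorteningMetric F G = modifiedMetric Es F (G + ((1 / Es : ℝ) : ℂ) • 1) := by
  funext y x
  simp only [shorteningMetric, modifiedMetric, add_mulVec, smul_mulVec, one_mulVec, dotProduct_add,
    dotProduct_smul, Complex.add_re, smul_eq_mul, Complex.re_ofReal_mul]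
  ring

lemma isAirPM_iff_isOptimalModified {N : ℕ} (H : Matrix (Fin M) (Fin N) ℂ)
    (F : Matrix (Fin M) (Fin N) ℂ) (G : Matrix (Fin N) (Fin N) ℂ) :
    IsAirPM ν H Es N0 F G ↔
      IsOptimalModified ν H Es N0 F (G + ((1 / Es : ℝ) : ℂ) • 1) := by
  simp only [IsAirPM, IsOptimalModified, shorteningMetric_eq_modifiedMetric Es]
  refine and_congr_right fun _ => ⟨fun h F' G' hG' => ?_, fun h F' G' => h F' _⟩
  have := h F' (G' - ((1 / Es : ℝ) : ℂ) • 1)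
  rw [sub_add_cancel] at this
  exact this hG'

end Optimality

end Mimo

open Mimo
theorem theorem3 {M ν k : ℕ} (hν : 1 ≤ ν) (hk : 1 ≤ k) (hM : ν + k ≤ M)
    (H : Matrix (Fin M) (Fin (ν + k)) ℂ) (Es N0 : ℝ) (hEs : 0 < Es) (hN0 : 0 < N0)
    (Qa : Matrix (Fin M ⊕ Fin (ν + k)) (Fin (ν + k)) ℂ)
    (La : Matrix (Fin (ν + k)) (Fin (ν + k)) ℂ)
    (hQL : IsThinQL (augmentedChannel H Es N0) Qa La)
    (Lap Gopt : Matrix (Fin (ν + k)) (Fin (ν + k)) ℂ) (hLap : Lap = puncturedMatrix La)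
    (hGopt : Gopt = Lapᴴ * Lap)
    (Fopt : Matrix (Fin M) (Fin (ν + k)) ℂ) (hFopt : Fopt = (mmseFilter H Es N0)ᴴ * Gopt) :
    -- the factor `Lap` is punctured of order `ν`, with positive real diagonal
    (IsPunctured ν Lap ∧ HasPosDiag Lap) ∧
    -- `(Fopt, Gopt)` is a maximizer, and it is the only one
    (∀ F G, IsOptimalModified ν H Es N0 F G ↔ F = Fopt ∧ G = Gopt) ∧
    -- the rate lower bound attained by the AWLD, which is the optimal value
    airLowerBound H Es N0 (modifiedMetric Es Fopt Gopt) =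
      ((((ν + k : ℕ) : ℝ) * Real.log Es + Real.log (Lapᴴ * Lap).det.re : ℝ) : EReal) ∧
    -- the AIR-PM detector is the AWLD: the same parameters, the same metric
    (∀ F G, IsAirPM ν H Es N0 F G ↔ F = Fopt ∧ G = Gopt - ((1 / Es : ℝ) : ℂ) • 1) ∧
    (∀ y x, shorteningMetric Fopt (Gopt - ((1 / Es : ℝ) : ℂ) • 1) y x =
      modifiedMetric Es Fopt Gopt y x) := by
  subst hFopt hGopt hLap
  refine ⟨⟨isPunctured_puncturedMatrix hQL.lower hQL.posDiag,
    hasPosDiag_puncturedMatrix hQL.lower hQL.posDiag⟩, isOptimalModified_iff H hEs hN0 hQL,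
    airLowerBound_puncturedMatrix H hEs hN0 hQL, fun F G => ?_, fun y x => ?_⟩
  · rw [isAirPM_iff_isOptimalModified, isOptimalModified_iff H hEs hN0 hQL, eq_sub_iff_add_eq]
  · rw [shorteningMetric_eq_modifiedMetric Es, sub_add_cancel]
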